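/- Let $k$ be a field, $Q$ a finite quiver (paths are composed from left to right), $kQ$ its path algebra, $J$ the ideal of $kQ$ generated by the arrows, and $I$ an admissible ideal of $kQ$, i.e. $J^m\subseteq I\subseteq J^2$ for some $m\ge 2$. Put $\Lambda=kQ/I$, and let $\operatorname{mod}$ denote the category of finitely generated right modules. Let $a_i\colon v_{e_i}\to v_{f_i}$, $i=1,\dots,t$, be arrows of $Q$, where $e_i,f_i$ are the trivial paths at the source and the target of $a_i$. Assume that there is a minimal generating set of the two-sided ideal $I$ such that no $a_i$ occurs in any path of any of its elements, and that $\operatorname{Hom}_\Lambda(e_i\Lambda,f_j\Lambda)=0$ for all $i,j\in\{1,\dots,t\}$. Let $\Gamma=\Lambda/\Lambda\{\overline a_i\}_{i=1}^t\Lambda$, let $\pi\colon\Lambda\to\Gamma$ be the projection, and let $\nu\colon\Gamma\to\Lambda$ be the natural algebra inclusion, which sends the class of a path of $Q$ in which no $a_i$ occurs to the class of the same path in $\Lambda$. Consider the functors - $\mathsf e\colon\operatorname{mod}\Lambda\to\operatorname{mod}\Gamma$, the restriction along $\nu$ (that is, $\operatorname{Hom}_\Lambda({}_\Gamma\Lambda_\Lambda,-)$),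 - $\mathsf i\colon\operatorname{mod}\Gamma\to\operatorname{mod}\Lambda$, the inflation, i.e. restriction along $\pi$ (that is, $\operatorname{Hom}_\Gamma({}_\Lambda\Gamma_\Gamma,-)$), - $\mathsf l=-\otimes_\Gamma{}_\Gamma\Lambda_\Lambda$ and $\mathsf r=\operatorname{Hom}_\Gamma({}_\Lambda\Lambda_\Gamma,-)$, both $\operatorname{mod}\Gamma\to\operatorname{mod}\Lambda$. Then $(\operatorname{mod}\Gamma,\operatorname{mod}\Lambda,\mathsf e,\mathsf l,\mathsf i)$ is a cleft extension of abelian categories, that is, 1. $\mathsf e$ is faithful and exact, 2. $(\mathsf l,\mathsf e)$ is an adjoint pair, 3. $\mathsf e\,\mathsf i\simeq\operatorname{Id}_{\operatorname{mod}\Gamma}$. Moreover, 4. $\mathsf l$ and $\mathsf r$ are exact, 5. $\mathsf e$ preserves projective objects. Let $G\colon\operatorname{mod}\Lambda\to\operatorname{mod}\Lambda$, $G(A)=\operatorname{Ker}(\mathsf l\mathsf e(A)\to A)$, be the kernel of the counit of the adjunction $(\mathsf l,\mathsf e)$, and let $F=\mathsf e\,G\,\mathsf i\colon\operatorname{mod}\Gamma\to\operatorname{mod}\Gamma$.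 Then 6. every object in the essential image $\operatorname{Im}F$ is projective in $\operatorname{mod}\Gamma$, 7. $F^2=0$, 8. every object in the essential image $\operatorname{Im}G$ is projective in $\operatorname{mod}\Lambda$. -/

import Mathlib

open CategoryTheory CategoryTheory.Limits

universe u v w x

noncomputable section

namespace ArrowRemoval

/-- Paths of all lengths (including the trivial ones) in a quiver, with arbitrary end points. -/
abbrev QPath (V : Type u) [Quiver.{v} V] : Type (max u v) :=
  Σ x y : V, Quiver.Path x y

/-- The list of arrows that a path runs through. -/
def arrows {V : Type u} [Quiver.{v} V] {x : V} :
    {y : V} → Quiver.Path x y → List (Quiver.Total V)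
  | _, .nil => []
  | _, .cons p a => arrows p ++ [⟨_, _, a⟩]

theorem arrows_comp {V : Type u} [Quiver.{v} V] {x y : V} (p : Quiver.Path x y) :
    ∀ {z : V} (q : Quiver.Path y z), arrows (p.comp q) = arrows p ++ arrows q
  | _, .nil => by simp [arrows]
  | _, .cons q a => by simp [arrows, arrows_comp p q]

section PathAlgebra

variable (k : Type w) [Field k] (V : Type u) [Quiver.{v} V]

/-- The underlying vector space of the path algebra `kQ`: it has the paths of `Q` as a basis. -/
def PathAlgebra : Type (max u v w) := QPath V →₀ k

instance : AddCommGroup (PathAlgebra k V) := inferInstanceAs (AddCommGroup (QPath V →₀ k))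
instance : Module k (PathAlgebra k V) := inferInstanceAs (Module k (QPath V →₀ k))

variable {k V}

/-- The basis element of the path algebra given by a path. -/
def ofPath (k : Type w) [Field k] {V : Type u} [Quiver.{v} V] (p : QPath V) : PathAlgebra k V :=
  Finsupp.single p (1 : k)

/-- The set of paths that occur in an element of the path algebra. -/
def support (x : PathAlgebra k V) : Finset (QPath V) := Finsupp.support x

open Classical in
/-- The product of two paths: their concatenation `pq` (first `p`, then `q`) if `p` ends where `q`
starts, and `0` otherwise. -/
def mulPath (k : Type w) [Field k] {V : Type u} [Quiver.{v} V] (p q : QPath V) :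
    PathAlgebra k V :=
  if h : q.1 = p.2.1 then ofPath k ⟨p.1, q.2.1, p.2.2.comp (q.2.2.cast h rfl)⟩ else 0

/-- The linear map out of the path algebra with prescribed values on paths. -/
def liftLin {M : Type*} [AddCommGroup M] [Module k M] (f : QPath V → M) :
    PathAlgebra k V →ₗ[k] M :=
  Finsupp.linearCombination k f

theorem liftLin_ofPath {M : Type*} [AddCommGroup M] [Module k M] (f : QPath V → M)
    (p : QPath V) : liftLin f (ofPath k p) = f p := by
  exact (Finsupp.linearCombination_single k (1 : k) p).trans (one_smul k _)

theorem lin_ext {M : Type*} [AddCommGroup M] [Module k M] {f g : PathAlgebra k V →ₗ[k] M}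
    (h : ∀ p, f (ofPath k p) = g (ofPath k p)) : f = g :=
  Finsupp.lhom_ext' fun p => LinearMap.ext_ring (h p)

/-- The multiplication of the path algebra, the bilinear extension of `mulPath`. -/
def mulLin : PathAlgebra k V →ₗ[k] PathAlgebra k V →ₗ[k] PathAlgebra k V :=
  liftLin fun p => liftLin fun q => mulPath k p q

instance : Mul (PathAlgebra k V) := ⟨fun x y => mulLin x y⟩

theorem mul_def (x y : PathAlgebra k V) : x * y = mulLin x y := rfl

theorem ofPath_mul_ofPath (p q : QPath V) : ofPath k p * ofPath k q = mulPath k p q := by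
  simp only [mul_def, mulLin, liftLin_ofPath]

theorem ofPath_mul_comp {x y z : V} (p : Quiver.Path x y) (q : Quiver.Path y z) :
    ofPath k ⟨x, y, p⟩ * ofPath k ⟨y, z, q⟩ = ofPath k ⟨x, z, p.comp q⟩ := by
  simp [ofPath_mul_ofPath, mulPath]

theorem ofPath_mul_ne {p q : QPath V} (h : q.1 ≠ p.2.1) : ofPath k p * ofPath k q = 0 := by
  simp [ofPath_mul_ofPath, mulPath, h]

/-- The trivial path at a vertex, an idempotent of the path algebra. -/
def idem (k : Type w) [Field k] {V : Type u} [Quiver.{v} V] (x : V) : PathAlgebra k V :=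
  ofPath k ⟨x, x, .nil⟩

instance [Fintype V] : One (PathAlgebra k V) := ⟨∑ x : V, idem k x⟩

theorem one_def [Fintype V] : (1 : PathAlgebra k V) = ∑ x : V, idem k x := rfl


/-- To prove a property of all elements of `kQ`, prove it for paths, and that it is preserved by
linear combinations. -/
@[elab_as_elim]
theorem path_induction {P : PathAlgebra k V → Prop} (x : PathAlgebra k V)
    (path : ∀ p, P (ofPath k p)) (zero : P 0) (add : ∀ x y, P x → P y → P (x + y))
    (smul : ∀ (c : k) x, P x → P (c • x)) : P x := by
  refine Finsupp.induction_linear x zero add fun p c => ?_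
  have h : (Finsupp.single p c : QPath V →₀ k) = c • Finsupp.single p (1 : k) := by simp
  rw [h]
  exact smul c _ (path p)

theorem add_mul_aux (x y z : PathAlgebra k V) : (x + y) * z = x * z + y * z := by
  simp [mul_def]

theorem mul_add_aux (x y z : PathAlgebra k V) : x * (y + z) = x * y + x * z := by
  simp [mul_def]

theorem smul_mul_aux (c : k) (x y : PathAlgebra k V) : c • x * y = c • (x * y) := by
  simp [mul_def]

theorem mul_smul_aux (c : k) (x y : PathAlgebra k V) : x * c • y = c • (x * y) := by
  simp [mul_def]

theorem zero_mul_aux (x : PathAlgebra k V) : 0 * x = 0 := by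
  simp [mul_def]

theorem mul_zero_aux (x : PathAlgebra k V) : x * 0 = 0 := by
  simp [mul_def]

theorem mul_assoc_path (p q r : QPath V) :
    ofPath k p * ofPath k q * ofPath k r = ofPath k p * (ofPath k q * ofPath k r) := by
  obtain ⟨x, y, p⟩ := p
  obtain ⟨y', z, q⟩ := q
  obtain ⟨z', t, r⟩ := r
  by_cases h : y' = y
  · subst h
    rw [ofPath_mul_comp]
    by_cases h' : z' = z
    · subst h'
      rw [ofPath_mul_comp, ofPath_mul_comp, ofPath_mul_comp, Quiver.Path.comp_assoc]
    · rw [ofPath_mul_ne h', ofPath_mul_ne h', mul_zero_aux]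
  · rw [ofPath_mul_ne h, zero_mul_aux]
    by_cases h' : z' = z
    · subst h'
      rw [ofPath_mul_comp, ofPath_mul_ne (by exact h)]
    · rw [ofPath_mul_ne h', mul_zero_aux]

theorem mul_assoc_aux (x y z : PathAlgebra k V) : x * y * z = x * (y * z) := by
  induction x using path_induction with
  | path p =>
    induction y using path_induction with
    | path q =>
      induction z using path_induction with
      | path r => exact mul_assoc_path p q r
      | zero => simp only [mul_zero_aux]
      | add z z' h h' => simp only [mul_add_aux, h, h']
      | smul c z h => simp only [mul_smul_aux, h]
    | zero => simp only [mul_zero_aux, zero_mul_aux]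
    | add z z' h h' => simp only [mul_add_aux, add_mul_aux, h, h']
    | smul c z h => simp only [mul_smul_aux, smul_mul_aux, h]
  | zero => simp only [zero_mul_aux]
  | add z z' h h' => simp only [add_mul_aux, h, h']
  | smul c z h => simp only [smul_mul_aux, h]

variable [Fintype V]

theorem one_mul_aux (x : PathAlgebra k V) : 1 * x = x := by
  induction x using path_induction with
  | path p =>
    obtain ⟨x, y, p⟩ := p
    have h : (1 : PathAlgebra k V) * ofPath k ⟨x, y, p⟩ =
        ∑ z : V, idem k z * ofPath k ⟨x, y, p⟩ := by
      simp [one_def, mul_def, LinearMap.sum_apply]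
    rw [h, Finset.sum_eq_single x, idem, ofPath_mul_comp, Quiver.Path.nil_comp]
    · intro z _ hz
      exact ofPath_mul_ne (Ne.symm hz)
    · simp
  | zero => exact mul_zero_aux _
  | add x y h h' => rw [mul_add_aux, h, h']
  | smul c x h => rw [mul_smul_aux, h]

theorem mul_one_aux (x : PathAlgebra k V) : x * 1 = x := by
  induction x using path_induction with
  | path p =>
    obtain ⟨x, y, p⟩ := p
    have h : ofPath k ⟨x, y, p⟩ * (1 : PathAlgebra k V) =
        ∑ z : V, ofPath k ⟨x, y, p⟩ * idem k z := by
      simp [one_def, mul_def]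
    rw [h, Finset.sum_eq_single y, idem, ofPath_mul_comp, Quiver.Path.comp_nil]
    · intro z _ hz
      exact ofPath_mul_ne hz
    · simp
  | zero => exact zero_mul_aux _
  | add x y h h' => rw [add_mul_aux, h, h']
  | smul c x h => rw [smul_mul_aux, h]

instance : Ring (PathAlgebra k V) where
  left_distrib := mul_add_aux
  right_distrib := add_mul_aux
  zero_mul := zero_mul_aux
  mul_zero := mul_zero_aux
  mul_assoc := mul_assoc_aux
  one_mul := one_mul_aux
  mul_one := mul_one_aux
  neg_add_cancel := neg_add_cancel
  zsmul := fun n x => n • x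
  zsmul_zero' := SubNegMonoid.zsmul_zero'
  zsmul_succ' := SubNegMonoid.zsmul_succ'
  zsmul_neg' := SubNegMonoid.zsmul_neg'
  sub_eq_add_neg := sub_eq_add_neg
  nsmul := fun n x => n • x
  nsmul_zero := AddMonoid.nsmul_zero
  nsmul_succ := AddMonoid.nsmul_succ

instance : Algebra k (PathAlgebra k V) := Algebra.ofModule smul_mul_aux mul_smul_aux

/-- The two-sided ideal of the path algebra generated by all arrows. -/
def arrowIdeal (k : Type w) [Field k] (V : Type u) [Quiver.{v} V] [Fintype V] :
    TwoSidedIdeal (PathAlgebra k V) :=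
  .span (Set.range fun a : Quiver.Total V => ofPath k ⟨a.left, a.right, a.hom.toPath⟩)

/-- A two-sided ideal `I` of `kQ` is admissible if `J ^ m ⊆ I ⊆ J ^ 2` for some `m ≥ 2`, where `J`
is the ideal generated by the arrows. -/
class IsAdmissible (I : TwoSidedIdeal (PathAlgebra k V)) : Prop where
  pow_le : ∃ m : ℕ, 2 ≤ m ∧ (arrowIdeal k V).asIdeal ^ m ≤ I.asIdeal
  le_sq : I.asIdeal ≤ (arrowIdeal k V).asIdeal ^ 2

/-- The arrows `a i` do not occur in a minimal set of generators of the ideal `I`: there is an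
(inclusion-)minimal set `S` that generates `I` as a two-sided ideal, such that no `a i` occurs in a
path of an element of `S`. -/
def AvoidsMinimalGenerators (I : TwoSidedIdeal (PathAlgebra k V)) {t : ℕ}
    (a : Fin t → Quiver.Total V) : Prop :=
  ∃ S : Set (PathAlgebra k V), Minimal (fun T => TwoSidedIdeal.span T = I) S ∧
    ∀ x ∈ S, ∀ p ∈ support x, ∀ i, a i ∉ arrows p.2.2

/-- The quotient algebra `Λ = kQ / I`. -/
abbrev Lam (I : TwoSidedIdeal (PathAlgebra k V)) : Type _ := PathAlgebra k V ⧸ I.asIdeal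

/-- The two-sided ideal of `Λ = kQ / I` generated by the classes of the arrows `a i`. -/
def removedIdeal (I : TwoSidedIdeal (PathAlgebra k V)) {t : ℕ} (a : Fin t → Quiver.Total V) :
    TwoSidedIdeal (Lam I) :=
  .span (Set.range fun i =>
    Ideal.Quotient.mk I.asIdeal (ofPath k ⟨(a i).left, (a i).right, (a i).hom.toPath⟩))

/-- The arrow removal `Γ = Λ / Λ{a i}Λ`. -/
abbrev Gam (I : TwoSidedIdeal (PathAlgebra k V)) {t : ℕ} (a : Fin t → Quiver.Total V) : Type _ :=
  Lam I ⧸ (removedIdeal I a).asIdeal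

/-- The projection `π : Λ → Γ`. -/
def proj (I : TwoSidedIdeal (PathAlgebra k V)) {t : ℕ} (a : Fin t → Quiver.Total V) :
    Lam I →ₐ[k] Gam I a :=
  Ideal.Quotient.mkₐ k _

/-- The right ideal `eΛ` of `Λ` generated by the class `e` of the trivial path at a vertex. -/
def rightIdeal (I : TwoSidedIdeal (PathAlgebra k V)) (x : V) : Submodule (Lam I)ᵐᵒᵖ (Lam I) :=
  Submodule.span (Lam I)ᵐᵒᵖ {Ideal.Quotient.mk I.asIdeal (idem k x)}

section Finiteness

theorem ofPath_mem_pow {x : V} : ∀ {y : V} (p : Quiver.Path x y),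
    ofPath k ⟨x, y, p⟩ ∈ (arrowIdeal k V).asIdeal ^ p.length
  | _, .nil => by simp [Submodule.pow_zero]
  | _, .cons p a => by
    have h := ofPath_mul_comp (k := k) p a.toPath
    have h' : p.comp a.toPath = p.cons a := rfl
    rw [h'] at h
    have ha : ofPath k ⟨_, _, a.toPath⟩ ∈ (arrowIdeal k V).asIdeal :=
      TwoSidedIdeal.mem_asIdeal.2 (TwoSidedIdeal.subset_span ⟨⟨_, _, a⟩, rfl⟩)
    rw [← h, Quiver.Path.length_cons, Submodule.pow_succ]
    exact Ideal.mul_mem_mul (ofPath_mem_pow p) ha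

variable [∀ x y : V, Finite (x ⟶ y)]

theorem finite_paths (m : ℕ) : {p : QPath V | p.2.2.length = m}.Finite := by
  induction m with
  | zero =>
    refine (Set.finite_range fun x : V => (⟨x, x, .nil⟩ : QPath V)).subset ?_
    rintro ⟨x, y, p⟩ h
    cases p with
    | nil => exact ⟨x, rfl⟩
    | cons p a => simp at h
  | succ m ih =>
    have : Finite {p : QPath V | p.2.2.length = m} := ih
    refine (Set.finite_range fun q : (Σ p : {p : QPath V | p.2.2.length = m},
        Σ y : V, (p.1.2.1 ⟶ y)) =>
      (⟨q.1.1.1, q.2.1, q.1.1.2.2.cons q.2.2⟩ : QPath V)).subset ?_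
    rintro ⟨x, y, p⟩ h
    cases p with
    | nil => simp at h
    | cons p a => exact ⟨⟨⟨⟨_, _, p⟩, by simpa using h⟩, _, a⟩, rfl⟩

instance (I : TwoSidedIdeal (PathAlgebra k V)) [hI : IsAdmissible I] : Module.Finite k (Lam I) := by
  obtain ⟨m, -, hm⟩ := hI.pow_le
  have hfin : {p : QPath V | p.2.2.length < m}.Finite := by
    refine ((Set.finite_lt_nat m).biUnion fun n _ => finite_paths (V := V) n).subset ?_
    intro p hp
    simp only [Set.mem_iUnion]
    exact ⟨_, hp, rfl⟩
  let q : PathAlgebra k V →ₗ[k] Lam I := (Ideal.Quotient.mkₐ k I.asIdeal).toLinearMap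
  refine ⟨Submodule.fg_def.2 ⟨(fun p => q (ofPath k p)) '' {p : QPath V | p.2.2.length < m},
    hfin.image _, ?_⟩⟩
  rw [eq_top_iff]
  rintro x -
  obtain ⟨y, rfl⟩ : ∃ y, q y = x := Ideal.Quotient.mk_surjective x
  induction y using path_induction with
  | path p =>
    by_cases hp : p.2.2.length < m
    · exact Submodule.subset_span ⟨p, hp, rfl⟩
    · have h0 : q (ofPath k p) = 0 := Ideal.Quotient.eq_zero_iff_mem.2
        (hm (Ideal.pow_le_pow_right (not_lt.1 hp) (ofPath_mem_pow p.2.2)))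
      rw [h0]
      exact Submodule.zero_mem _
  | zero => rw [map_zero]; exact Submodule.zero_mem _
  | add x y h h' => rw [map_add]; exact Submodule.add_mem _ h h'
  | smul c x h => rw [map_smul]; exact Submodule.smul_mem _ c h

end Finiteness


section Section

variable {t : ℕ} (a : Fin t → Quiver.Total V)

open Classical in
/-- The endomorphism of `kQ` that fixes the paths in which no `a i` occurs and that sends
all other paths to `0`. -/
def kill : PathAlgebra k V →ₐ[k] PathAlgebra k V :=
  AlgHom.ofLinearMap
    (liftLin fun p => if ∀ i, a i ∉ arrows p.2.2 then ofPath k p else 0)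
    (by simp [one_def, idem, liftLin_ofPath, arrows])
    (by
      intro x y
      induction x using path_induction with
      | path p =>
        induction y using path_induction with
        | path q =>
          obtain ⟨x, y, p⟩ := p
          obtain ⟨y', z, q⟩ := q
          by_cases h : y' = y
          · subst h
            rw [ofPath_mul_comp, liftLin_ofPath, liftLin_ofPath, liftLin_ofPath]
            by_cases hp : ∀ i, a i ∉ arrows p
            · by_cases hq : ∀ i, a i ∉ arrows q
              · rw [if_pos hp, if_pos hq, ofPath_mul_comp, if_pos]
                simpa [arrows_comp] using fun i => ⟨hp i, hq i⟩
              · rw [if_neg hq, mul_zero, if_neg]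
                simp only [arrows_comp, List.mem_append, not_or]
                exact fun H => hq fun i => (H i).2
            · rw [if_neg hp, zero_mul, if_neg]
              simp only [arrows_comp, List.mem_append, not_or]
              exact fun H => hp fun i => (H i).1
          · rw [ofPath_mul_ne h, map_zero, liftLin_ofPath, liftLin_ofPath]
            have h0 : ofPath k ⟨x, y, p⟩ * ofPath k ⟨y', z, q⟩ = 0 := ofPath_mul_ne h
            split_ifs <;> simp only [h0, mul_zero, zero_mul]
        | zero => simp
        | add x y h h' => rw [mul_add, map_add, map_add, mul_add, h, h']
        | smul c x h => rw [mul_smul_comm, map_smul, map_smul, mul_smul_comm, h]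
      | zero => simp
      | add x y h h' => rw [add_mul, map_add, map_add, add_mul, h, h']
      | smul c x h => rw [smul_mul_assoc, map_smul, map_smul, smul_mul_assoc, h])

theorem kill_ofPath_of_avoids {p : QPath V} (hp : ∀ i, a i ∉ arrows p.2.2) :
    kill a (ofPath k p) = ofPath k p := by
  change liftLin _ (ofPath k p) = _
  rw [liftLin_ofPath, if_pos hp]

theorem kill_ofPath_of_mem {p : QPath V} (i : Fin t) (hp : a i ∈ arrows p.2.2) :
    kill a (ofPath k p) = 0 := by
  change liftLin _ (ofPath k p) = _
  rw [liftLin_ofPath, if_neg fun H => H i hp]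

theorem kill_of_avoids {x : PathAlgebra k V} (hx : ∀ p ∈ support x, ∀ i, a i ∉ arrows p.2.2) :
    kill a x = x := by
  have h : x = ∑ p ∈ support x, (DFunLike.coe (F := QPath V →₀ k) x p) • ofPath k p := by
    conv_lhs => rw [← Finsupp.sum_single (α := QPath V) (M := k) x]
    refine Finset.sum_congr rfl fun p _ => ?_
    exact (Finsupp.smul_single_one p _).symm
  rw [h, map_sum]
  exact Finset.sum_congr rfl fun p hp => by rw [map_smul, kill_ofPath_of_avoids a (hx p hp)]

variable {a} {I : TwoSidedIdeal (PathAlgebra k V)}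

theorem kill_mem (ha : AvoidsMinimalGenerators I a) {x : PathAlgebra k V} (hx : x ∈ I) :
    kill a x ∈ I := by
  obtain ⟨S, ⟨hS, -⟩, hSa⟩ := ha
  have h : TwoSidedIdeal.span S ≤ I.comap (kill (k := k) a) := by
    rw [TwoSidedIdeal.span_le]
    intro y hy
    rw [SetLike.mem_coe, TwoSidedIdeal.mem_comap, kill_of_avoids a (hSa y hy), ← hS]
    exact TwoSidedIdeal.subset_span hy
  exact (TwoSidedIdeal.mem_comap _).1 (h (hS ▸ hx))

/-- The endomorphism of `Λ` induced by `kill`. -/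
def killLam (ha : AvoidsMinimalGenerators I a) : Lam I →ₐ[k] Lam I :=
  Ideal.Quotient.liftₐ I.asIdeal ((Ideal.Quotient.mkₐ k I.asIdeal).comp (kill a)) fun _ hx =>
    Ideal.Quotient.eq_zero_iff_mem.2 (kill_mem ha hx)

theorem killLam_eq_zero (ha : AvoidsMinimalGenerators I a) {x : Lam I}
    (hx : x ∈ removedIdeal I a) : killLam ha x = 0 := by
  have h : removedIdeal I a ≤ TwoSidedIdeal.ker (killLam ha) := by
    rw [removedIdeal, TwoSidedIdeal.span_le]
    rintro _ ⟨i, rfl⟩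
    rw [SetLike.mem_coe, TwoSidedIdeal.mem_ker]
    change Ideal.Quotient.mk I.asIdeal (kill a _) = 0
    rw [kill_ofPath_of_mem a i, map_zero]
    simp [Quiver.Hom.toPath, arrows]
  exact (TwoSidedIdeal.mem_ker _).1 (h hx)

/-- The natural algebra inclusion `ν : Γ → Λ`: it sends the class of a path in which no `a i`
occurs to the class of the same path. -/
def incl (ha : AvoidsMinimalGenerators I a) : Gam I a →ₐ[k] Lam I :=
  Ideal.Quotient.liftₐ (removedIdeal I a).asIdeal (killLam ha) fun _ hx => killLam_eq_zero ha hx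

end Section

end PathAlgebra

section Functors

open TensorProduct

section Extend

variable {A B : Type x} [Ring A] [Ring B] (f : A →+* B)

/-- The relations `b f(a) ⊗ m = b ⊗ a m` that turn `B ⊗_ℤ M` into `B ⊗_A M`. -/
def tensorRelations (M : Type x) [AddCommGroup M] [Module A M] : Submodule B (B ⊗[ℤ] M) :=
  Submodule.span B {z | ∃ (b : B) (a : A) (m : M), z = (b * f a) ⊗ₜ[ℤ] m - b ⊗ₜ[ℤ] (a • m)}

/-- The tensor product `B ⊗_A M` over a (not necessarily commutative) ring `A`, as a left
`B`-module. -/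
abbrev ExtTensor (M : Type x) [AddCommGroup M] [Module A M] : Type x :=
  (B ⊗[ℤ] M) ⧸ tensorRelations f M

/-- The map `B ⊗_A g`. -/
def ExtTensor.map {M N : Type x} [AddCommGroup M] [Module A M] [AddCommGroup N] [Module A N]
    (g : M →ₗ[A] N) : ExtTensor f M →ₗ[B] ExtTensor f N :=
  Submodule.mapQ _ _ (AlgebraTensorModule.lTensor B B g.toAddMonoidHom.toIntLinearMap) (by
    rw [tensorRelations, Submodule.span_le]
    rintro _ ⟨b, a, m, rfl⟩
    refine Submodule.subset_span ⟨b, a, g m, ?_⟩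
    simp)

theorem ExtTensor.hom_ext {M N : Type x} [AddCommGroup M] [Module A M] [AddCommGroup N]
    [Module B N] {g h : ExtTensor f M →ₗ[B] N}
    (H : ∀ (b : B) (m : M),
      g (Submodule.Quotient.mk (b ⊗ₜ m)) = h (Submodule.Quotient.mk (b ⊗ₜ m))) :
    g = h := by
  refine Submodule.linearMap_qext _ ?_
  refine LinearMap.ext fun z => ?_
  induction z using TensorProduct.induction_on with
  | zero => simp
  | tmul b m => exact H b m
  | add y z hy hz => rw [map_add, map_add, hy, hz]

/-- Extension of scalars `B ⊗_A -` from left `A`-modules to left `B`-modules. -/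
def extend : ModuleCat.{x} A ⥤ ModuleCat.{x} B where
  obj M := ModuleCat.of B (ExtTensor f M)
  map g := ModuleCat.ofHom (ExtTensor.map f g.hom)
  map_id M := by
    ext1
    exact ExtTensor.hom_ext f fun b m => by simp [ExtTensor.map]
  map_comp g h := by
    ext1
    exact ExtTensor.hom_ext f fun b m => by simp [ExtTensor.map]

theorem extend_fg (M : ModuleCat.{x} A) (hM : ModuleCat.isFG A M) :
    ModuleCat.isFG B ((extend f).obj M) := by
  obtain ⟨S, hS⟩ := (hM : Module.Finite A M).fg_top
  let u : M → ExtTensor f M := fun m => Submodule.Quotient.mk ((1 : B) ⊗ₜ m)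
  have hu : ∀ (b : B) (m : M), (Submodule.Quotient.mk (b ⊗ₜ m) : ExtTensor f M) = b • u m := by
    intro b m
    rw [← Submodule.Quotient.mk_smul, TensorProduct.smul_tmul', smul_eq_mul, mul_one]
  have hu1 : ∀ (a : A) (m : M), u (a • m) = f a • u m := by
    intro a m
    rw [← hu]
    refine ((Submodule.Quotient.eq _).2 ?_).symm
    exact Submodule.subset_span ⟨1, a, m, by simp⟩
  refine ⟨Submodule.fg_def.2 ⟨u '' S, S.finite_toSet.image u, ?_⟩⟩
  have key : ∀ m, u m ∈ Submodule.span B (u '' S) := by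
    intro m
    have hm : m ∈ Submodule.span A (S : Set M) := hS ▸ Submodule.mem_top
    induction hm using Submodule.span_induction with
    | mem m h => exact Submodule.subset_span ⟨m, h, rfl⟩
    | zero => simp [u]
    | add m n _ _ h h' =>
      have : u (m + n) = u m + u n := by simp [u, tmul_add]
      rw [this]
      exact Submodule.add_mem _ h h'
    | smul a m _ h => rw [hu1]; exact Submodule.smul_mem _ _ h
  rw [eq_top_iff]
  rintro z -
  obtain ⟨z, rfl⟩ := Submodule.Quotient.mk_surjective _ z
  induction z using TensorProduct.induction_on with
  | zero => exact Submodule.zero_mem _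
  | tmul b m => rw [hu]; exact Submodule.smul_mem _ _ (key m)
  | add y z hy hz => rw [Submodule.Quotient.mk_add]; exact Submodule.add_mem _ hy hz

end Extend

variable {k : Type w} [Field k] {A B : Type x} [Ring A] [Ring B] [Algebra k A] [Algebra k B]
  (f : A →ₐ[k] B)

theorem restrict_fg [Module.Finite k B] (M : ModuleCat.{x} B) (hM : ModuleCat.isFG B M) :
    ModuleCat.isFG A ((ModuleCat.restrictScalars.{x} f.toRingHom).obj M) := by
  have : Module.Finite B M := hM
  let _ : Module k M := Module.compHom M (algebraMap k B)
  let _ : Module A M := Module.compHom M f.toRingHom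
  have : IsScalarTower k B M := ⟨fun c b m => by
    rw [Algebra.smul_def, mul_smul]; rfl⟩
  have : IsScalarTower k A M := ⟨fun c a m => by
    change f (c • a) • m = algebraMap k B c • (f a • m)
    rw [map_smul, Algebra.smul_def, mul_smul]⟩
  have : Module.Finite k M := Module.Finite.trans B M
  exact Module.Finite.of_restrictScalars_finite k A M

theorem coextend_fg [Module.Finite k A] [Module.Finite k B] (M : ModuleCat.{x} A)
    (hM : ModuleCat.isFG A M) :
    ModuleCat.isFG B ((ModuleCat.coextendScalars.{x} f.toRingHom).obj M) := by
  have : Module.Finite A M := hM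
  let _ : Module k M := Module.compHom M (algebraMap k A)
  have : IsScalarTower k A M := ⟨fun c b m => by
    rw [Algebra.smul_def, mul_smul]; rfl⟩
  have : Module.Finite k M := Module.Finite.trans A M
  let N := (ModuleCat.coextendScalars.{x} f.toRingHom).obj M
  let _ : Module k N := Module.compHom N (algebraMap k B)
  have : IsScalarTower k B N := ⟨fun c b m => by
    rw [Algebra.smul_def, mul_smul]; rfl⟩
  let lin (g : N) : (ModuleCat.restrictScalars.{x} f.toRingHom).obj (ModuleCat.of B B) →ₗ[A] M := g
  have key : ∀ (g : N) (c : k) (b : B), lin g (c • b : B) = c • lin g b := by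
    intro g c b
    have h := (lin g).map_smul (algebraMap k A c) b
    refine Eq.trans (congrArg (lin g) ?_) h
    change c • b = f (algebraMap k A c) * b
    rw [AlgHom.commutes, Algebra.smul_def]
  let ev : N →ₗ[k] (B →ₗ[k] M) :=
    { toFun g := { toFun b := lin g b, map_add' := (lin g).map_add, map_smul' := key g }
      map_add' g h := rfl
      map_smul' c g := by
        refine LinearMap.ext fun b => ?_
        refine Eq.trans (congrArg (lin g) ?_) (key g c b)
        change b * algebraMap k B c = c • b
        rw [Algebra.smul_def, Algebra.commutes] }
  have hev : Function.Injective ev := fun g h H =>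
    LinearMap.ext (f := lin g) (g := lin h) fun b => LinearMap.congr_fun H b
  have : Module.Finite k N := Module.Finite.of_injective ev hev
  exact Module.Finite.of_restrictScalars_finite k B N

/-- Restriction of scalars along `f : A → B`, on finitely generated left modules. -/
def restrictFG [Module.Finite k B] : FGModuleCat.{x} B ⥤ FGModuleCat.{x} A :=
  (ModuleCat.isFG A).lift ((ModuleCat.isFG B).ι ⋙ ModuleCat.restrictScalars.{x} f.toRingHom)
    fun M => restrict_fg f M.obj M.property

/-- Extension of scalars `B ⊗_A -` along `f : A → B`, on finitely generated left modules. -/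
def extendFG : FGModuleCat.{x} A ⥤ FGModuleCat.{x} B :=
  (ModuleCat.isFG B).lift ((ModuleCat.isFG A).ι ⋙ extend f.toRingHom)
    fun M => extend_fg _ M.obj M.property

/-- Coextension of scalars `Hom_A(B, -)` along `f : A → B`, on finitely generated left modules. -/
def coextendFG [Module.Finite k A] [Module.Finite k B] : FGModuleCat.{x} A ⥤ FGModuleCat.{x} B :=
  (ModuleCat.isFG B).lift ((ModuleCat.isFG A).ι ⋙ ModuleCat.coextendScalars.{x} f.toRingHom)
    fun M => coextend_fg f M.obj M.property

end Functors


section Cleft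

universe v₁ u₁ v₂ u₂

/-- A cleft extension `(ℬ, 𝒜, e, l, i)` of abelian categories: `e` is faithful exact, `l` is left
adjoint to `e`, and `e i ≅ Id`. -/
structure CleftExtension {ℬ : Type u₁} {𝒜 : Type u₂} [Category.{v₁} ℬ] [Category.{v₂} 𝒜]
    [Abelian ℬ] [Abelian 𝒜] (e : 𝒜 ⥤ ℬ) (l : ℬ ⥤ 𝒜) (i : ℬ ⥤ 𝒜) where
  faithful : e.Faithful
  exact : exactFunctor 𝒜 ℬ e
  adj : l ⊣ e
  iso : i ⋙ e ≅ 𝟭 ℬ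

namespace CleftExtension

variable {ℬ : Type u₁} {𝒜 : Type u₂} [Category.{v₁} ℬ] [Category.{v₂} 𝒜] [Abelian ℬ] [Abelian 𝒜]
  {e : 𝒜 ⥤ ℬ} {l : ℬ ⥤ 𝒜} {i : ℬ ⥤ 𝒜} (C : CleftExtension e l i)

/-- The endofunctor `G` of `𝒜`, the kernel of the counit `l e ⟶ Id`. -/
def G : 𝒜 ⥤ 𝒜 where
  obj X := kernel (C.adj.counit.app X)
  map {X Y} g := kernel.map _ _ (l.map (e.map g)) g (C.adj.counit.naturality g).symm

/-- The endofunctor `F = e G i` of `ℬ`. -/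
def F : ℬ ⥤ ℬ := i ⋙ C.G ⋙ e

end CleftExtension

end Cleft

section Main

variable {k : Type w} [Field k] {V : Type u} [Quiver.{v} V] [Fintype V]
  [∀ x y : V, Finite (x ⟶ y)]

/-- The category of finitely generated right modules over a ring `R`. -/
abbrev ModR (R : Type x) [Ring R] := FGModuleCat.{x} Rᵐᵒᵖ

/-- A ring that is finite dimensional over a field is right Noetherian. -/
instance isNoetherianRing_lam (I : TwoSidedIdeal (PathAlgebra k V)) [IsAdmissible I] :
    IsNoetherianRing (Lam I)ᵐᵒᵖ := IsNoetherianRing.of_finite k _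

instance isNoetherianRing_gam (I : TwoSidedIdeal (PathAlgebra k V)) [IsAdmissible I] {t : ℕ}
    (a : Fin t → Quiver.Total V) : IsNoetherianRing (Gam I a)ᵐᵒᵖ := IsNoetherianRing.of_finite k _

variable (I : TwoSidedIdeal (PathAlgebra k V)) [IsAdmissible I] {t : ℕ}
    (a : Fin t → Quiver.Total V) (ha : AvoidsMinimalGenerators I a)

/-- `i = Hom_Γ(Γ, -) : mod Γ → mod Λ`, the inflation (restriction along `π : Λ → Γ`). -/
def functorI : ModR (Gam I a) ⥤ ModR (Lam I) := restrictFG (proj I a).op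

variable {I a}

/-- `e = Hom_Λ(Λ, -) : mod Λ → mod Γ`, the restriction along `ν : Γ → Λ`. -/
def functorE : ModR (Lam I) ⥤ ModR (Gam I a) := restrictFG (incl ha).op

/-- `l = - ⊗_Γ Λ : mod Γ → mod Λ`. Right modules being left modules over the opposite ring, this is
extension of scalars along `Γᵐᵒᵖ → Λᵐᵒᵖ`. -/
def functorL : ModR (Gam I a) ⥤ ModR (Lam I) := extendFG (incl ha).op

/-- `r = Hom_Γ(Λ, -) : mod Γ → mod Λ`, where `Hom_Γ` denotes maps of right `Γ`-modules. -/
def functorR : ModR (Gam I a) ⥤ ModR (Lam I) := coextendFG (incl ha).op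

end Main

end ArrowRemoval

end

open ArrowRemoval

/-! Right modules are treated as left modules over the opposite algebras, so put `A = Γᵒᵖ`, `B =
Λᵒᵖ`, with `f : A → B` from `ν` and `g : B → A` from `π`, where `g ∘ f = id`. Everything follows
from one description of `B` over `A`, recorded in `RemovalData`. Each removed arrow gives an element
`r` of `B`, idempotents `ε` (source) and `φ` (target), and a derivation `D : B → A ⊗_k A` that
vanishes on `f A`. Every `x` in `B` equals `f (g x)` plus the sum of the `f v * r * f u` with `v ⊗
u` running through `D x`.

The derivation of `kQ` sums `q ⊗ p` over the factorizations `p α q` of a path. It descends to `Λ`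
because it kills generators of `I` that avoid the removed arrows (`deriv_eq_zero`). The Hom
condition says `f_j Λ e_i = 0`, so a path through two removed arrows vanishes in `Λ`; this gives the
decomposition of `x` (`op_eq_add_sum_sandwich`).

Consequences: `B` is a left `A`-module retract of a sum of `A` and copies of the free module `A ⊗_k
A`, so it is projective, `r` is exact and its left adjoint `e` preserves projectives. Applying `D`
to the first factor of `B ⊗_A M` gives coordinates in `M` and `B ⊗_k M` that are natural in `M` and
jointly injective. As `B` is flat over the field `k`, `l` is exact.

The kernel of `B ⊗_A M → M` is a `B`-linear retract of a sum of copies of the free module `B ⊗_k M`: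
the coordinate maps have as retraction the sum of the maps `b ⊗ m ↦ b r ⊗ m - b ⊗ r m`. So values of
`G` are projective, and hence those of `F = e G i` are too. Finally every `ε` annihilates this
kernel, while the kernel is zero when every `ε` annihilates `M`; thus `F² = 0`. -/

namespace ArrowRemoval

open TensorProduct

/-! ### Maps out of `B ⊗_A M`. -/

section AddLift

variable {A B : Type x} [Ring A] [Ring B] (f : A →+* B)

/-- The class of `b ⊗ m` in `B ⊗_A M`. -/
def ExtTensor.tmul {M : Type x} [AddCommGroup M] [Module A M] (b : B) (m : M) : ExtTensor f M :=
  Submodule.Quotient.mk (b ⊗ₜ m)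

variable {M : Type x} [AddCommGroup M] [Module A M]

theorem ExtTensor.tmul_add (b : B) (m n : M) : tmul f b (m + n) = tmul f b m + tmul f b n := by
  simp [tmul, TensorProduct.tmul_add]

theorem ExtTensor.add_tmul (b c : B) (m : M) : tmul f (b + c) m = tmul f b m + tmul f c m := by
  simp [tmul, TensorProduct.add_tmul]

theorem ExtTensor.zero_tmul (m : M) : tmul f (0 : B) m = 0 := by
  simp [tmul]

theorem ExtTensor.tmul_zero (b : B) : tmul f b (0 : M) = 0 := by
  simp [tmul]

theorem ExtTensor.smul_tmul (b c : B) (m : M) : b • tmul f c m = tmul f (b * c) m := rfl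

theorem ExtTensor.mul_tmul (b : B) (a : A) (m : M) : tmul f (b * f a) m = tmul f b (a • m) :=
  (Submodule.Quotient.eq _).2 (Submodule.subset_span ⟨b, a, m, rfl⟩)

theorem ExtTensor.map_tmul {N : Type x} [AddCommGroup N] [Module A N] (h : M →ₗ[A] N) (b : B)
    (m : M) : ExtTensor.map f h (tmul f b m) = tmul f b (h m) := rfl

@[elab_as_elim]
theorem ExtTensor.induction_on {P : ExtTensor f M → Prop} (z : ExtTensor f M) (zero : P 0)
    (tmul : ∀ b m, P (tmul f b m)) (add : ∀ y z, P y → P z → P (y + z)) : P z := by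
  obtain ⟨z, rfl⟩ := Submodule.Quotient.mk_surjective _ z
  induction z using TensorProduct.induction_on with
  | zero => exact zero
  | tmul b m => exact tmul b m
  | add y z hy hz => exact add _ _ hy hz

/-- The additive map out of `B ⊗_A M` induced by an `A`-balanced biadditive map. -/
def ExtTensor.lift {N : Type*} [AddCommGroup N] (φ : B →+ M →+ N)
    (h : ∀ b a m, φ (b * f a) m = φ b (a • m)) : ExtTensor f M →+ N :=
  QuotientAddGroup.lift (tensorRelations f M).toAddSubgroup
    (TensorProduct.liftAddHom φ fun n b m => by
      rw [map_zsmul, map_zsmul, AddMonoidHom.zsmul_apply]) (by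
      intro z hz
      rw [Submodule.mem_toAddSubgroup] at hz
      rw [tensorRelations] at hz
      -- The lifted map is only additive, so the `B`-span is reached through sums of multiples `c •
      -- z` of the relations.
      refine Submodule.closure_induction (p := fun z _ => TensorProduct.liftAddHom φ _ z = 0)
        (map_zero _) (fun y z _ _ hy hz => by rw [map_add, hy, hz, add_zero]) ?_ hz
      rintro c _ ⟨b, a, m, rfl⟩
      rw [smul_sub, TensorProduct.smul_tmul', TensorProduct.smul_tmul', map_sub,
        TensorProduct.liftAddHom_tmul, TensorProduct.liftAddHom_tmul, smul_eq_mul, smul_eq_mul,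
        ← mul_assoc, h, sub_self])

theorem ExtTensor.lift_tmul {N : Type*} [AddCommGroup N] (φ : B →+ M →+ N)
    (h : ∀ b a m, φ (b * f a) m = φ b (a • m)) (b : B) (m : M) :
    ExtTensor.lift f φ h (tmul f b m) = φ b m := rfl

/-- The `B`-linear map `B ⊗_A M → N` that corresponds to an additive map `M → N` that is
semilinear with respect to `f : A → B`. -/
def ExtTensor.desc {N : Type x} [AddCommGroup N] [Module B N] (h : M →+ N)
    (hh : ∀ (a : A) m, h (a • m) = f a • h m) : ExtTensor f M →ₗ[B] N :=
  { ExtTensor.lift f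
      ({ toFun := fun b => (DistribSMul.toAddMonoidHom N b).comp h
         map_zero' := by ext; simp
         map_add' := fun b c => by ext; simp [add_smul] } : B →+ M →+ N)
      (fun b a m => by
        change (b * f a) • h m = b • h (a • m)
        rw [hh, mul_smul]) with
    map_smul' := fun b z => by
      change ExtTensor.lift f _ _ (b • z) = b • ExtTensor.lift f _ _ z
      induction z using ExtTensor.induction_on with
      | zero => simp
      | tmul c m =>
        rw [ExtTensor.smul_tmul, ExtTensor.lift_tmul, ExtTensor.lift_tmul]
        exact mul_smul b c (h m)
      | add y z hy hz => rw [smul_add, map_add, map_add, hy, hz, smul_add] }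

end AddLift

/-! ### Split extensions of algebras with coefficient derivations. -/

section Sandwich

variable {k : Type w} [Field k] {A B : Type x} [Ring A] [Ring B] [Algebra k A] [Algebra k B]
  (f : A →ₐ[k] B)

/-- The map `v ⊗ u ↦ f v * r * f u`. -/
def sandwich (r : B) : A ⊗[k] A →ₗ[k] B :=
  LinearMap.mul' k B ∘ₗ
    TensorProduct.map (LinearMap.mulRight k r ∘ₗ f.toLinearMap) f.toLinearMap

theorem sandwich_tmul (r : B) (v u : A) : sandwich f r (v ⊗ₜ u) = f v * r * f u := rfl

theorem sandwich_mul (r : B) (a : A) (w : A ⊗[k] A) :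
    sandwich f r ((a ⊗ₜ 1) * w) = f a * sandwich f r w := by
  induction w with
  | zero => rw [mul_zero, map_zero, mul_zero]
  | tmul v u =>
    rw [Algebra.TensorProduct.tmul_mul_tmul, one_mul, sandwich_tmul, sandwich_tmul, map_mul,
      mul_assoc, mul_assoc, mul_assoc]
  | add y z hy hz => rw [mul_add, map_add, map_add, hy, hz, mul_add]

end Sandwich

/-- A split extension `f : A → B`, `g : B → A` of algebras together with elements `r α` of `B` such
that the kernel of `g` is, as an `A`-bimodule, generated by the `r α`, and freely so up to the
idempotents `φ α` and `ε α`: this is expressed by the derivations `D α : B → A ⊗ A` that return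
the coefficients at `r α`. -/
structure RemovalData (k : Type w) [Field k] (A B : Type x) [Ring A] [Ring B] [Algebra k A]
    [Algebra k B] (f : A →ₐ[k] B) (E : Type*) [Fintype E] where
  g : B →ₐ[k] A
  g_f : ∀ a, g (f a) = a
  r : E → B
  ε : E → A
  φ : E → A
  D : E → B →ₗ[k] A ⊗[k] A
  D_mul : ∀ α x y, D α (x * y) = (g x ⊗ₜ 1) * D α y + D α x * (1 ⊗ₜ g y)
  D_f : ∀ α a, D α (f a) = 0
  ε_mul_D : ∀ α x, (1 ⊗ₜ ε α) * D α x = D α x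
  D_mul_φ : ∀ α x, D α x * (φ α ⊗ₜ 1) = D α x
  decomp : ∀ x, x = f (g x) + ∑ α, sandwich f (r α) (D α x)
  φ_mul_r : ∀ α, f (φ α) * r α = r α
  r_mul_ε : ∀ α, r α * f (ε α) = r α
  vanish : ∀ α β x, f (ε α) * x * f (φ β) = 0

namespace RemovalData

variable {k : Type w} [Field k] {A B : Type x} [Ring A] [Ring B] [Algebra k A]
    [Algebra k B] {f : A →ₐ[k] B} {E : Type*} [Fintype E] (R : RemovalData k A B f E)

/-- The map `v ⊗ u ↦ f v * r α * f u`. -/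
def μ (α : E) : A ⊗[k] A →ₗ[k] B := sandwich f (R.r α)

theorem μ_tmul (α : E) (v u : A) : R.μ α (v ⊗ₜ u) = f v * R.r α * f u := rfl

theorem eq_add_sum (x : B) : x = f (R.g x) + ∑ α, R.μ α (R.D α x) := R.decomp x

theorem ε_mul_r (α β : E) (x : B) : f (R.ε α) * x * R.r β = 0 := by
  rw [← R.φ_mul_r β, ← mul_assoc, R.vanish, zero_mul]

theorem r_mul_φ (α β : E) (x : B) : R.r α * x * f (R.φ β) = 0 := by
  rw [← R.r_mul_ε α, mul_assoc, mul_assoc, ← mul_assoc (f _), R.vanish, mul_zero]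

theorem ε_mul_μ (α β : E) (x : B) (w : A ⊗[k] A) : f (R.ε α) * x * R.μ β w = 0 := by
  induction w with
  | zero => simp
  | tmul v u => rw [μ_tmul, ← mul_assoc, ← mul_assoc, mul_assoc (f _) x, R.ε_mul_r, zero_mul]
  | add y z hy hz => rw [map_add, mul_add, hy, hz, add_zero]

theorem μ_mul_φ (α β : E) (x : B) (w : A ⊗[k] A) : R.μ α w * x * f (R.φ β) = 0 := by
  induction w with
  | zero => simp
  | tmul v u =>
    rw [μ_tmul, mul_assoc _ (f u), mul_assoc, mul_assoc, ← mul_assoc (R.r α), R.r_mul_φ, mul_zero]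
  | add y z hy hz => rw [map_add, add_mul, add_mul, hy, hz, add_zero]

/-- The difference of `y` and `f (g y)` is a sum of terms containing some `r β`, and `ε` kills these
from the left. To the right of an `ε`, the action through `g` thus agrees with the original one. -/
theorem ε_mul_f_g (α : E) (x y : B) : f (R.ε α) * x * f (R.g y) = f (R.ε α) * x * y := by
  conv_rhs => rw [R.eq_add_sum y]
  rw [mul_add, Finset.mul_sum, Finset.sum_eq_zero fun β _ => R.ε_mul_μ α β x _, add_zero]

/-- Mirror image of `ε_mul_f_g`: a term containing `r β` dies in front of any `φ`. -/
theorem f_g_mul_φ (α : E) (x y : B) : f (R.g y) * x * f (R.φ α) = y * x * f (R.φ α) := by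
  conv_rhs => rw [R.eq_add_sum y]
  rw [add_mul, add_mul, Finset.sum_mul, Finset.sum_mul,
    Finset.sum_eq_zero fun β _ => R.μ_mul_φ β α x _, add_zero]

/-! ### Projectivity of `B` over `A`. -/

section Projective

theorem tmul_one_mul (a : A) (w : A ⊗[k] A) : (a ⊗ₜ 1) * w = a • w := by
  induction w with
  | zero => rw [mul_zero, smul_zero]
  | tmul v u => rw [Algebra.TensorProduct.tmul_mul_tmul, one_mul]; rfl
  | add y z hy hz => rw [mul_add, hy, hz, smul_add]

variable (f) in
/-- Restriction of scalars of the left regular module along `f`. -/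
abbrev regular : Type x := (ModuleCat.restrictScalars.{x} f.toRingHom).obj (ModuleCat.of B B)

include R in
-- The map `b ↦ (g b, D b)` has a retraction by the decomposition formula. It is `A`-linear because
-- `D` vanishes on `f A`, and `A ⊗_k A` is free over its left factor because `k` is a field.
theorem projective_regular : Module.Projective A (regular f) := by
  let i : regular f →ₗ[A] A × (E →₀ A ⊗[k] A) := LinearMap.prod
    { toFun := fun b : B => R.g b
      map_add' := fun b c => map_add R.g _ _
      map_smul' := fun a b => (map_mul R.g (f a) b).trans (by rw [R.g_f]; rfl) }
    { toFun := fun b : B => Finsupp.equivFunOnFinite.symm fun α => R.D α b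
      map_add' := fun b c => by ext α; exact map_add (R.D α) _ _
      map_smul' := fun a b => by
        ext α
        refine (R.D_mul α (f a) b).trans ?_
        rw [R.D_f, zero_mul, add_zero, R.g_f]
        exact tmul_one_mul a (R.D α b) }
  let mu (α : E) : A ⊗[k] A →ₗ[A] regular f :=
    { R.μ α with
      map_smul' := fun a w => by
        change R.μ α (a • w) = f a * R.μ α w
        induction w with
        | zero => simp
        | tmul v u => simp [TensorProduct.smul_tmul', μ_tmul, mul_assoc]
        | add y z hy hz => rw [smul_add, map_add, map_add, hy, hz, mul_add] }
  let f' : A →ₗ[A] regular f :=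
    { toFun := f
      map_add' := map_add f
      map_smul' := fun a b => map_mul f a b }
  let s : A × (E →₀ A ⊗[k] A) →ₗ[A] regular f :=
    LinearMap.coprod f' (Finsupp.lsum ℕ mu)
  refine Module.Projective.of_split i s (LinearMap.ext fun b => ?_)
  refine Eq.trans ?_ (R.eq_add_sum b).symm
  exact congrArg (fun y : B => f (R.g b) + y)
    (Finsupp.sum_fintype (Finsupp.equivFunOnFinite.symm fun α => R.D α b) (fun α => mu α)
      fun α => map_zero _)

end Projective

/-! ### Coordinates on `B ⊗_A M` and exactness of the tensor product. -/

section Tau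

variable {M : Type x} [AddCommGroup M] [Module A M] [Module k M] [IsScalarTower k A M]

variable (f) in
/-- The map `v ⊗ u ↦ f v ⊗ u m`. -/
def actAt (m : M) : A ⊗[k] A →ₗ[k] B ⊗[k] M :=
  TensorProduct.map f.toLinearMap ((LinearMap.toSpanSingleton A M m).restrictScalars k)

theorem actAt_tmul (m : M) (v u : A) : actAt f m (v ⊗ₜ[k] u) = f v ⊗ₜ (u • m) := rfl

theorem actAt_add (m n : M) (w : A ⊗[k] A) : actAt f (m + n) w = actAt f m w + actAt f n w := by
  induction w with
  | zero => simp
  | tmul v u => simp only [actAt_tmul, smul_add, TensorProduct.tmul_add]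
  | add y z hy hz => rw [map_add, map_add, map_add, hy, hz]; abel

theorem actAt_zero (w : A ⊗[k] A) : actAt f (0 : M) w = 0 := by
  induction w with
  | zero => simp
  | tmul v u => simp only [actAt_tmul, smul_zero, TensorProduct.tmul_zero]
  | add y z hy hz => rw [map_add, hy, hz, add_zero]

theorem actAt_smul (a : A) (m : M) (w : A ⊗[k] A) :
    actAt f (a • m) w = actAt f m (w * (1 ⊗ₜ a)) := by
  induction w with
  | zero => simp
  | tmul v u => simp [actAt_tmul, mul_smul]
  | add y z hy hz => rw [map_add, add_mul, map_add, hy, hz]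

theorem smul_actAt (a : A) (m : M) (w : A ⊗[k] A) :
    f a • actAt f m w = actAt f m ((a ⊗ₜ 1) * w) := by
  induction w with
  | zero => simp
  | tmul v u => simp [actAt_tmul, TensorProduct.smul_tmul']
  | add y z hy hz => rw [map_add, mul_add, map_add, smul_add, hy, hz]

theorem lTensor_actAt {N : Type x} [AddCommGroup N] [Module A N] [Module k N] [IsScalarTower k A N]
    (h : M →ₗ[A] N) (m : M) (w : A ⊗[k] A) :
    (h.restrictScalars k).lTensor B (actAt f m w) = actAt f (h m) w := by
  induction w with
  | zero => simp
  | tmul v u => simp [actAt_tmul]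
  | add y z hy hz => rw [map_add, map_add, map_add, hy, hz]

/-- The map `B ⊗_A M → B ⊗_k M` that sends `x ⊗ m` to `f v ⊗ u m` if `D α x = v ⊗ u`. -/
def τ (α : E) : ExtTensor f.toRingHom M →+ B ⊗[k] M :=
  ExtTensor.lift f.toRingHom
    (AddMonoidHom.mk' (fun x => AddMonoidHom.mk' (fun m => actAt f m (R.D α x))
        fun m n => actAt_add m n _)
      fun x y => by ext m; simp)
    (fun b a m => by
      change actAt f m (R.D α (b * f a)) = actAt f (a • m) (R.D α b)
      rw [R.D_mul, R.D_f, mul_zero, zero_add, R.g_f, actAt_smul])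

theorem τ_tmul (α : E) (x : B) (m : M) :
    R.τ α (ExtTensor.tmul f.toRingHom x m) = actAt f m (R.D α x) := rfl

/-- The map `B ⊗_A M → M` that sends `x ⊗ m` to `g x • m`. -/
def θ : ExtTensor f.toRingHom M →+ M :=
  ExtTensor.lift f.toRingHom
    (AddMonoidHom.mk' (fun x => DistribSMul.toAddMonoidHom M (R.g x))
      fun x y => by ext m; simp [add_smul])
    (fun b a m => by
      change R.g (b * f a) • m = R.g b • a • m
      rw [map_mul, R.g_f, mul_smul])

omit [Module k M] [IsScalarTower k A M] in
theorem θ_tmul (x : B) (m : M) : R.θ (ExtTensor.tmul f.toRingHom x m) = R.g x • m := rfl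

theorem tmul_smul_comm (c : k) (b : B) (m : M) :
    ExtTensor.tmul f.toRingHom (c • b) m = ExtTensor.tmul f.toRingHom b (c • m) := by
  rw [Algebra.smul_def, Algebra.commutes, ← f.commutes, ← algebraMap_smul A c m]
  exact ExtTensor.mul_tmul f.toRingHom b _ m

/-- The map `B ⊗_k M → B ⊗_A M` that sends `b ⊗ m` to `b * c ⊗ m`. -/
def σ (c : B) : B ⊗[k] M →+ ExtTensor f.toRingHom M :=
  TensorProduct.liftAddHom
    (AddMonoidHom.mk' (fun b => AddMonoidHom.mk' (fun m => ExtTensor.tmul f.toRingHom (b * c) m)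
        fun m n => ExtTensor.tmul_add _ _ _ _)
      fun x y => by
        ext m
        simp only [AddMonoidHom.mk'_apply, AddMonoidHom.add_apply, add_mul, ExtTensor.add_tmul])
    (fun a b m => by
      change ExtTensor.tmul f.toRingHom ((a • b) * c) m = ExtTensor.tmul f.toRingHom (b * c) (a • m)
      rw [smul_mul_assoc, tmul_smul_comm])

theorem σ_tmul (c b : B) (m : M) :
    σ (f := f) c (b ⊗ₜ[k] m) = ExtTensor.tmul f.toRingHom (b * c) m := rfl

theorem σ_actAt (α : E) (m : M) (w : A ⊗[k] A) :
    σ (R.r α) (actAt f m w) = ExtTensor.tmul f.toRingHom (R.μ α w) m := by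
  induction w with
  | zero => rw [map_zero, map_zero, map_zero, ExtTensor.zero_tmul]
  | tmul v u =>
    rw [actAt_tmul, σ_tmul, μ_tmul]
    exact (ExtTensor.mul_tmul f.toRingHom _ _ _).symm
  | add y z hy hz => rw [map_add, map_add, map_add, hy, hz, ExtTensor.add_tmul]

omit [Module k M] [IsScalarTower k A M] in
theorem sum_tmul {ι : Type*} (s : Finset ι) (b : ι → B) (m : M) :
    ExtTensor.tmul f.toRingHom (∑ i ∈ s, b i) m = ∑ i ∈ s, ExtTensor.tmul f.toRingHom (b i) m :=
  map_sum (AddMonoidHom.mk' (fun b => ExtTensor.tmul f.toRingHom b m)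
    fun _ _ => ExtTensor.add_tmul _ _ _ _) b s

omit [Module k M] [IsScalarTower k A M] in
theorem f_tmul (a : A) (m : M) :
    ExtTensor.tmul f.toRingHom (f a) m = ExtTensor.tmul f.toRingHom 1 (a • m) := by
  rw [← ExtTensor.mul_tmul, one_mul]; rfl

/-- The decomposition of `x`, tensored with `m`: the coordinates `θ` and `τ` determine `z`. -/
theorem eq_tmul_add_sum_σ (z : ExtTensor f.toRingHom M) :
    z = ExtTensor.tmul f.toRingHom 1 (R.θ z) + ∑ α, σ (R.r α) (R.τ α z) := by
  induction z using ExtTensor.induction_on with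
  | zero => simp only [map_zero, ExtTensor.tmul_zero, Finset.sum_const_zero, add_zero]
  | tmul x m =>
    conv_lhs => rw [R.eq_add_sum x]
    simp only [ExtTensor.add_tmul, sum_tmul, τ_tmul, σ_actAt, θ_tmul, f_tmul]
  | add y z hy hz =>
    simp only [map_add, ExtTensor.tmul_add, Finset.sum_add_distrib]
    conv_lhs => rw [hy, hz]
    abel

include R in
-- Both coordinates are natural in the module. On `θ` the induced map is `h` itself and on `τ` it is
-- `B ⊗_k h`, so a kernel element has zero coordinates.
theorem map_injective {N : Type x} [AddCommGroup N] [Module A N] [Module k N]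
    [IsScalarTower k A N] (h : M →ₗ[A] N) (hh : Function.Injective h) :
    Function.Injective (ExtTensor.map f.toRingHom h) := by
  have hθ (z : ExtTensor f.toRingHom M) : R.θ (ExtTensor.map f.toRingHom h z) = h (R.θ z) := by
    induction z using ExtTensor.induction_on with
    | zero => simp only [map_zero]
    | tmul x m => rw [ExtTensor.map_tmul, θ_tmul, θ_tmul, map_smul]
    | add y z hy hz => simp only [map_add, hy, hz]
  have hτ (α : E) (z : ExtTensor f.toRingHom M) : R.τ α (ExtTensor.map f.toRingHom h z) =
      (h.restrictScalars k).lTensor B (R.τ α z) := by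
    induction z using ExtTensor.induction_on with
    | zero => simp only [map_zero]
    | tmul x m => rw [ExtTensor.map_tmul, τ_tmul, τ_tmul, lTensor_actAt]
    | add y z hy hz => simp only [map_add, hy, hz]
  rw [injective_iff_map_eq_zero]
  intro z hz
  rw [R.eq_tmul_add_sum_σ z]
  have h1 : R.θ z = 0 := hh (by rw [← hθ, hz, map_zero, map_zero])
  have h2 (α : E) : R.τ α z = 0 :=
    -- This is where the ground ring being a field enters: `B` is flat over `k`.
    Module.Flat.lTensor_preserves_injective_linearMap (M := B) (h.restrictScalars k) hh
      (by rw [← hτ, hz, map_zero, map_zero])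
  simp only [h1, h2, ExtTensor.tmul_zero, map_zero, Finset.sum_const_zero, add_zero]

end Tau

/-! ### The kernel of the multiplication map `B ⊗_A M → M`. -/

section Kernel

variable {M : Type x} [AddCommGroup M] [Module A M] [Module B M] [Module k M] [IsScalarTower k A M]
  [IsScalarTower k B M] (hM : ∀ (a : A) (m : M), a • m = f a • m)

/-- The multiplication map `B ⊗_A M → M` for a `B`-module `M`. -/
def counit : ExtTensor f.toRingHom M →ₗ[B] M :=
  ExtTensor.desc f.toRingHom (AddMonoidHom.id M) hM

omit [Module k M] [IsScalarTower k A M] [IsScalarTower k B M] in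
theorem counit_tmul (b : B) (m : M) : counit hM (ExtTensor.tmul f.toRingHom b m) = b • m := rfl

/-- The map `B ⊗_k M → B ⊗_A M` that sends `b ⊗ m` to `b * c ⊗ m - b ⊗ c m`. -/
def δAdd (c : B) : B ⊗[k] M →+ ExtTensor f.toRingHom M :=
  TensorProduct.liftAddHom
    (AddMonoidHom.mk' (fun b => AddMonoidHom.mk'
        (fun m => ExtTensor.tmul f.toRingHom (b * c) m - ExtTensor.tmul f.toRingHom b (c • m))
        fun m n => by simp only [smul_add, ExtTensor.tmul_add]; abel)
      fun x y => by
        ext m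
        simp only [AddMonoidHom.mk'_apply, AddMonoidHom.add_apply, add_mul, ExtTensor.add_tmul]
        abel)
    (fun a b m => by
      simp only [AddMonoidHom.mk'_apply]
      rw [smul_mul_assoc, tmul_smul_comm, tmul_smul_comm, smul_comm a c m])

theorem δAdd_tmul (c b : B) (m : M) : δAdd (f := f) c (b ⊗ₜ[k] m) =
    ExtTensor.tmul f.toRingHom (b * c) m - ExtTensor.tmul f.toRingHom b (c • m) := rfl

/-- The `B`-linear map `B ⊗_k M → B ⊗_A M` that sends `b ⊗ m` to `b * c ⊗ m - b ⊗ c m`. -/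
def δ (c : B) : B ⊗[k] M →ₗ[B] ExtTensor f.toRingHom M where
  toFun := δAdd c
  map_add' := map_add _
  map_smul' b z := by
    rw [RingHom.id_apply]
    induction z with
    | zero => rw [smul_zero, map_zero, smul_zero]
    | tmul d m =>
      rw [TensorProduct.smul_tmul', δAdd_tmul, δAdd_tmul, smul_sub, ExtTensor.smul_tmul,
        ExtTensor.smul_tmul, smul_eq_mul, mul_assoc]
    | add y z hy hz => rw [smul_add, map_add, map_add, hy, hz, smul_add]

theorem δ_tmul (c b : B) (m : M) : δ (f := f) c (b ⊗ₜ[k] m) =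
    ExtTensor.tmul f.toRingHom (b * c) m - ExtTensor.tmul f.toRingHom b (c • m) := rfl

theorem counit_δ (c : B) (z : B ⊗[k] M) : counit hM (δ c z) = 0 := by
  induction z with
  | zero => simp only [map_zero]
  | tmul b m => rw [δ_tmul, map_sub, counit_tmul, counit_tmul, mul_smul, sub_self]
  | add y z hy hz => rw [map_add, map_add, hy, hz, add_zero]

include hM in
theorem δ_actAt (α : E) (m : M) (w : A ⊗[k] A) :
    δ (R.r α) (actAt f m w) =
      ExtTensor.tmul f.toRingHom (R.μ α w) m - ExtTensor.tmul f.toRingHom 1 (R.μ α w • m) := by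
  induction w with
  | zero => simp only [map_zero, ExtTensor.zero_tmul, zero_smul, ExtTensor.tmul_zero, sub_zero]
  | tmul v u =>
    have h : ExtTensor.tmul f.toRingHom (f v * R.r α * f u) m =
        ExtTensor.tmul f.toRingHom (f v * R.r α) (u • m) := ExtTensor.mul_tmul f.toRingHom _ _ _
    rw [actAt_tmul, δ_tmul, μ_tmul, h, f_tmul, hM v, hM u, mul_smul, mul_smul]
  | add y z hy hz =>
    rw [map_add, map_add, map_add, hy, hz, ExtTensor.add_tmul, add_smul, ExtTensor.tmul_add]
    abel

/-- Unlike `σ`, the correction maps `δ` land in the kernel of the counit, so this form of the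
decomposition restricts to that kernel. -/
theorem eq_tmul_add_sum_δ (z : ExtTensor f.toRingHom M) :
    z = ExtTensor.tmul f.toRingHom 1 (counit hM z) + ∑ α, δ (R.r α) (R.τ α z) := by
  induction z using ExtTensor.induction_on with
  | zero => simp only [map_zero, ExtTensor.tmul_zero, Finset.sum_const_zero, add_zero]
  | tmul x m =>
    have h : ExtTensor.tmul f.toRingHom 1 (x • m) = ExtTensor.tmul f.toRingHom 1 (f (R.g x) • m) +
        ∑ α, ExtTensor.tmul f.toRingHom 1 (R.μ α (R.D α x) • m) := by
      conv_lhs => rw [R.eq_add_sum x, add_smul, Finset.sum_smul, ExtTensor.tmul_add]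
      congr 1
      exact map_sum (AddMonoidHom.mk' (fun m => ExtTensor.tmul f.toRingHom (1 : B) m)
        fun _ _ => ExtTensor.tmul_add _ _ _ _) _ _
    rw [counit_tmul, h]
    simp only [τ_tmul, R.δ_actAt hM, Finset.sum_sub_distrib]
    conv_lhs => rw [R.eq_add_sum x, ExtTensor.add_tmul, sum_tmul, f_tmul, hM]
    abel
  | add y z hy hz =>
    simp only [map_add, ExtTensor.tmul_add, Finset.sum_add_distrib]
    conv_lhs => rw [hy, hz]
    abel

theorem eq_sum_δ {z : ExtTensor f.toRingHom M} (hz : counit hM z = 0) :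
    z = ∑ α, δ (R.r α) (R.τ α z) := by
  conv_lhs => rw [R.eq_tmul_add_sum_δ hM z, hz, ExtTensor.tmul_zero, zero_add]

omit [IsScalarTower k B M] in
include hM in
-- The right tensor factors of `D α y` can be taken of the form `ε u`, and to the right of `ε` the
-- elements `x` and `f (g x)` agree.
theorem actAt_g_smul (α : E) (x y : B) (m : M) :
    actAt f (R.g x • m) (R.D α y) = actAt f (x • m) (R.D α y) := by
  rw [← R.ε_mul_D α y]
  generalize R.D α y = w
  induction w with
  | zero => simp only [map_zero, mul_zero]
  | tmul v u =>
    simp only [Algebra.TensorProduct.tmul_mul_tmul, one_mul, actAt_tmul]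
    rw [hM, hM, hM, map_mul, ← mul_smul, ← mul_smul, R.ε_mul_f_g]
  | add y z hy hz => rw [mul_add, map_add, map_add, hy, hz]

omit [Module B M] [IsScalarTower k B M] in
-- The left tensor factors of `D α x` can be taken of the form `v φ`, and to the left of `φ` the
-- elements `y` and `f (g y)` agree.
theorem g_smul_τ (α : E) (y : B) (z : ExtTensor f.toRingHom M) :
    f (R.g y) • R.τ α z = y • R.τ α z := by
  induction z using ExtTensor.induction_on with
  | zero => simp only [map_zero, smul_zero]
  | tmul x m =>
    rw [τ_tmul, ← R.D_mul_φ α x]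
    generalize R.D α x = w
    induction w with
    | zero => simp only [map_zero, smul_zero, zero_mul]
    | tmul v u =>
      simp only [Algebra.TensorProduct.tmul_mul_tmul, mul_one, actAt_tmul, map_mul,
        TensorProduct.smul_tmul', smul_eq_mul, ← mul_assoc, R.f_g_mul_φ]
    | add y z hy hz => rw [add_mul, map_add, smul_add, smul_add, hy, hz]
  | add y z hy hz => rw [map_add, smul_add, smul_add, hy, hz]

omit [IsScalarTower k B M] in
-- The Leibniz rule makes `τ` linear up to a term that depends on `z` only through the counit; hence
-- `τ` is `B`-linear on the kernel.
theorem τ_smul (α : E) (y : B) (z : ExtTensor f.toRingHom M) :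
    R.τ α (y • z) = y • R.τ α z + actAt f (counit hM z) (R.D α y) := by
  rw [← g_smul_τ]
  induction z using ExtTensor.induction_on with
  | zero => simp only [map_zero, actAt_zero, smul_zero, add_zero]
  | tmul x m =>
    rw [ExtTensor.smul_tmul, τ_tmul, τ_tmul, R.D_mul, map_add, counit_tmul,
      ← R.actAt_g_smul hM, smul_actAt, actAt_smul]
  | add y z hy hz =>
    rw [smul_add, map_add, map_add, hy, hz, smul_add, map_add, actAt_add]
    abel

include R in
-- `τ` embeds the kernel `B`-linearly into a sum of copies of `B ⊗_k M`, which is `B`-free, and `δ`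
-- retracts this embedding.
theorem projective_ker_counit : Module.Projective B (LinearMap.ker (counit hM)) := by
  let i : LinearMap.ker (counit hM) →ₗ[B] (E →₀ B ⊗[k] M) :=
    { toFun := fun z => Finsupp.equivFunOnFinite.symm fun α => R.τ α z.1
      map_add' := fun y z => by ext1 α; exact map_add (R.τ α) y.1 z.1
      map_smul' := fun b z => by
        ext1 α
        refine (R.τ_smul hM α b z.1).trans ?_
        rw [LinearMap.mem_ker.1 z.2, actAt_zero, add_zero]
        rfl }
  let s : (E →₀ B ⊗[k] M) →ₗ[B] LinearMap.ker (counit hM) :=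
    Finsupp.lsum ℕ fun α => LinearMap.codRestrict _ (δ (R.r α)) fun z =>
      LinearMap.mem_ker.2 (counit_δ hM _ z)
  refine Module.Projective.of_split i s (LinearMap.ext fun z => Subtype.ext ?_)
  refine Eq.trans ?_ (R.eq_sum_δ hM (LinearMap.mem_ker.1 z.2)).symm
  change ((Finsupp.equivFunOnFinite.symm fun α => R.τ α z.1).sum
    (fun α => LinearMap.codRestrict _ (δ (R.r α)) _) : LinearMap.ker (counit hM)).1 = _
  rw [Finsupp.sum_fintype _ _ fun α => map_zero _, Submodule.coe_sum]
  rfl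

/-- The first factors in `τ β z` have the form `f (v φ)`, so `vanish` applies, and the kernel is the
image of these elements under the linear maps `δ`. -/
theorem ε_smul_eq_zero (α : E) {z : ExtTensor f.toRingHom M} (hz : counit hM z = 0) :
    f (R.ε α) • z = 0 := by
  have key (β : E) : f (R.ε α) • R.τ β z = 0 := by
    clear hz
    induction z using ExtTensor.induction_on with
    | zero => simp only [map_zero, smul_zero]
    | tmul x m =>
      rw [τ_tmul, ← R.D_mul_φ β x]
      generalize R.D β x = w
      induction w with
      | zero => simp only [map_zero, smul_zero, zero_mul]
      | tmul v u =>
        simp only [Algebra.TensorProduct.tmul_mul_tmul, mul_one, actAt_tmul, map_mul,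
          TensorProduct.smul_tmul', smul_eq_mul, ← mul_assoc, R.vanish, TensorProduct.zero_tmul]
      | add y z hy hz => rw [add_mul, map_add, smul_add, hy, hz, add_zero]
    | add y z hy hz => rw [map_add, smul_add, hy, hz, add_zero]
  rw [R.eq_sum_δ hM hz, Finset.smul_sum]
  refine Finset.sum_eq_zero fun β _ => ?_
  rw [← map_smul, key, map_zero]

/-- The second factors in `τ α z` have the form `(ε u) • m`, which are zero, and `τ` determines
elements of the kernel. -/
theorem eq_zero_of_counit_eq_zero (hε : ∀ (α : E) (m : M), R.ε α • m = 0)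
    {z : ExtTensor f.toRingHom M} (hz : counit hM z = 0) : z = 0 := by
  have key (α : E) : R.τ α z = 0 := by
    clear hz
    induction z using ExtTensor.induction_on with
    | zero => simp only [map_zero]
    | tmul x m =>
      rw [τ_tmul, ← R.ε_mul_D α x]
      generalize R.D α x = w
      induction w with
      | zero => simp only [map_zero, mul_zero]
      | tmul v u =>
        simp only [Algebra.TensorProduct.tmul_mul_tmul, one_mul, actAt_tmul, mul_smul, hε,
          TensorProduct.tmul_zero]
      | add y z hy hz => rw [mul_add, map_add, hy, hz, add_zero]
    | add y z hy hz => rw [map_add, hy, hz, add_zero]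
  rw [R.eq_sum_δ hM hz]
  exact Finset.sum_eq_zero fun α _ => by rw [key, map_zero]

end Kernel

end RemovalData

/-! ### Epimorphisms, projectives and kernels of finitely generated modules. -/

section FG

variable {R : Type x} [Ring R] [IsNoetherianRing R]

theorem fg_surjective_of_epi {X Y : FGModuleCat.{x} R} (g : X ⟶ Y) [Epi g] :
    Function.Surjective g.hom.hom :=
  (ModuleCat.epi_iff_surjective ((forget₂ (FGModuleCat.{x} R) (ModuleCat.{x} R)).map g)).1
    inferInstance

theorem fg_injective_of_mono {X Y : FGModuleCat.{x} R} (g : X ⟶ Y) [Mono g] :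
    Function.Injective g.hom.hom :=
  (ModuleCat.mono_iff_injective ((forget₂ (FGModuleCat.{x} R) (ModuleCat.{x} R)).map g)).1
    inferInstance

theorem fg_epi_of_surjective {X Y : FGModuleCat.{x} R} (g : X ⟶ Y)
    (hg : Function.Surjective g.hom.hom) : Epi g :=
  (forget₂ (FGModuleCat.{x} R) (ModuleCat.{x} R)).epi_of_epi_map
    ((ModuleCat.epi_iff_surjective _).2 hg)

theorem fg_mono_of_injective {X Y : FGModuleCat.{x} R} (g : X ⟶ Y)
    (hg : Function.Injective g.hom.hom) : Mono g :=
  (forget₂ (FGModuleCat.{x} R) (ModuleCat.{x} R)).mono_of_mono_map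
    ((ModuleCat.mono_iff_injective _).2 hg)

theorem fg_projective (X : FGModuleCat.{x} R) [Module.Projective R X] : Projective X where
  factors {Y Z} g h _ := by
    obtain ⟨l, hl⟩ := Module.projective_lifting_property h.hom.hom g.hom.hom
      (fg_surjective_of_epi h)
    exact ⟨FGModuleCat.ofHom l, FGModuleCat.hom_ext hl⟩

omit [IsNoetherianRing R] in
theorem fg_isZero (X : FGModuleCat.{x} R) (h : ∀ z : X, z = 0) : IsZero X := by
  rw [IsZero.iff_id_eq_zero]
  ext z
  exact (h z).trans (h _).symm

/-- The kernel of a morphism of finitely generated modules is the usual one. -/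
noncomputable def fgKernelIso {X Y : FGModuleCat.{x} R} (g : X ⟶ Y) :
    kernel g ≅ FGModuleCat.of R (LinearMap.ker g.hom.hom) where
  hom := FGModuleCat.ofHom (LinearMap.codRestrict _ (kernel.ι g).hom.hom fun z =>
    LinearMap.congr_fun (congrArg (fun h : kernel g ⟶ Y => h.hom.hom) (kernel.condition g)) z)
  inv := kernel.lift g (FGModuleCat.ofHom (LinearMap.ker g.hom.hom).subtype) (by
    ext z
    exact z.2)
  hom_inv_id := by
    rw [← cancel_mono (kernel.ι g), Category.assoc, kernel.lift_ι, Category.id_comp]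
    rfl
  inv_hom_id := by
    have : Mono (FGModuleCat.ofHom (LinearMap.ker g.hom.hom).subtype) :=
      fg_mono_of_injective _ Subtype.val_injective
    rw [← cancel_mono (FGModuleCat.ofHom (LinearMap.ker g.hom.hom).subtype), Category.assoc,
      Category.id_comp]
    exact kernel.lift_ι g _ _

end FG

/-! ### Criteria for exactness of one-sided exact functors. -/

section Exactness

variable {C D : Type*} [Category C] [Category D] [Abelian C] [Abelian D] (F : C ⥤ D) [F.Additive]

theorem exactFunctor_of_preservesFiniteColimits [PreservesFiniteColimits F]
    (h : ∀ {X Y : C} (g : X ⟶ Y) [Mono g], Mono (F.map g)) : exactFunctor C D F := by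
  refine (exactFunctor_iff F).2 ⟨?_, inferInstance⟩
  rw [Functor.preservesFiniteLimits_iff_forall_exact_map_and_mono]
  intro S hS
  have := hS.mono_f
  exact ⟨((Functor.preservesFiniteColimits_iff_forall_exact_map_and_epi F).1 inferInstance S hS).1,
    h S.f⟩

theorem exactFunctor_of_preservesFiniteLimits [PreservesFiniteLimits F]
    (h : ∀ {X Y : C} (g : X ⟶ Y) [Epi g], Epi (F.map g)) : exactFunctor C D F := by
  refine (exactFunctor_iff F).2 ⟨inferInstance, ?_⟩
  rw [Functor.preservesFiniteColimits_iff_forall_exact_map_and_epi]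
  intro S hS
  have := hS.epi_g
  exact ⟨((Functor.preservesFiniteLimits_iff_forall_exact_map_and_mono F).1 inferInstance S hS).1,
    h S.g⟩

end Exactness

/-! ### Extension, restriction and coextension as adjoints. -/

section Adjunctions

variable {k : Type w} [Field k] {A B : Type x} [Ring A] [Ring B] [Algebra k A] [Algebra k B]
  (f : A →ₐ[k] B) [Module.Finite k A] [Module.Finite k B]

/-- Restriction of scalars is left adjoint to coextension of scalars. -/
noncomputable def restrictCoextendFGAdj : restrictFG f ⊣ coextendFG f :=
  (ModuleCat.restrictCoextendScalarsAdj.{x} f.toRingHom).restrictFullyFaithful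
    (ModuleCat.isFG B).fullyFaithfulι (ModuleCat.isFG A).fullyFaithfulι (Iso.refl _) (Iso.refl _)

omit [Module.Finite k A] in
/-- Extension of scalars is left adjoint to restriction of scalars. -/
noncomputable def extendRestrictFGAdj : extendFG f ⊣ restrictFG f :=
  Adjunction.mkOfUnitCounit
    { unit :=
        { app := fun X => ObjectProperty.homMk (ModuleCat.ofHom
            (Y := (ModuleCat.restrictScalars f.toRingHom).obj
              ((extend f.toRingHom).obj X.obj))
            { toFun := fun m => ExtTensor.tmul f.toRingHom 1 m
              map_add' := fun m n => ExtTensor.tmul_add _ _ _ _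
              map_smul' := fun a m => (ExtTensor.mul_tmul f.toRingHom 1 a m).symm.trans
                (by rw [one_mul, ← mul_one (f.toRingHom a)]; rfl) })
          naturality := fun X Y g => rfl }
      counit :=
        { app := fun X => ObjectProperty.homMk (ModuleCat.ofHom
            (RemovalData.counit (f := f)
              (M := (ModuleCat.restrictScalars f.toRingHom).obj X.obj) fun _ _ => rfl))
          naturality := fun X Y g => by
            ext1
            refine ExtTensor.hom_ext _ fun b m => ?_
            exact (g.hom.hom.map_smul b m).symm }
      left_triangle := by
        ext X : 2
        apply FGModuleCat.hom_ext
        refine ExtTensor.hom_ext _ fun b m => ?_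
        change b • ExtTensor.tmul f.toRingHom 1 m = ExtTensor.tmul f.toRingHom b m
        rw [ExtTensor.smul_tmul, mul_one]
      right_triangle := by
        ext X : 2
        apply FGModuleCat.hom_ext
        ext m
        exact one_smul B (show X.obj from m) }

end Adjunctions

section Additive

variable {k : Type w} [Field k] {A B : Type x} [Ring A] [Ring B] [Algebra k A] [Algebra k B]
  (f : A →ₐ[k] B)

instance restrictFG_additive [Module.Finite k B] : (restrictFG f).Additive where
  map_add := rfl

instance restrictFG_faithful [Module.Finite k B] : (restrictFG f).Faithful where
  map_injective {X Y g h} H := by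
    ext m
    exact LinearMap.congr_fun
      (congrArg (fun l : (restrictFG f).obj X ⟶ (restrictFG f).obj Y => l.hom.hom) H) m

instance extendFG_additive : (extendFG f).Additive where
  map_add {X Y g h} := by
    apply FGModuleCat.hom_ext
    refine ExtTensor.hom_ext _ fun b m => ?_
    exact ExtTensor.tmul_add f.toRingHom b (g.hom.hom m) (h.hom.hom m)

instance coextendFG_additive [Module.Finite k A] [Module.Finite k B] : (coextendFG f).Additive where
  map_add := rfl

variable [Module.Finite k A] [Module.Finite k B]

/-- Restriction has an adjoint on each side. -/
theorem restrictFG_exact [IsNoetherianRing A] [IsNoetherianRing B] :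
    exactFunctor _ _ (restrictFG f) := by
  have := (restrictCoextendFGAdj f).leftAdjoint_preservesColimits
  have := (extendRestrictFGAdj f).rightAdjoint_preservesLimits
  exact (exactFunctor_iff _).2 ⟨inferInstance, inferInstance⟩

end Additive

/-! ### The statements about functors, for any split extension of this kind. -/

namespace RemovalData

variable {k : Type w} [Field k] {A B : Type x} [Ring A] [Ring B] [Algebra k A]
    [Algebra k B] [Module.Finite k A] [Module.Finite k B] [IsNoetherianRing A] [IsNoetherianRing B]
    {f : A →ₐ[k] B} {E : Type*} [Fintype E] (R : RemovalData k A B f E)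

include R

omit [Module.Finite k A] in
theorem extendFG_exact : exactFunctor _ _ (extendFG f) := by
  have := (extendRestrictFGAdj f).leftAdjoint_preservesColimits
  refine exactFunctor_of_preservesFiniteColimits _ fun {X Y} g _ => fg_mono_of_injective _ ?_
  -- Bundled modules carry no `k`-structure; it is pulled back from the algebra.
  let _ : Module k X.obj := Module.compHom X.obj (algebraMap k A)
  let _ : Module k Y.obj := Module.compHom Y.obj (algebraMap k A)
  have : IsScalarTower k A X.obj := ⟨fun c a m => by rw [Algebra.smul_def, mul_smul]; rfl⟩
  have : IsScalarTower k A Y.obj := ⟨fun c a m => by rw [Algebra.smul_def, mul_smul]; rfl⟩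
  exact R.map_injective g.hom.hom (fg_injective_of_mono g)

theorem epi_coextendFG_map {X Y : FGModuleCat.{x} A} (g : X ⟶ Y) [Epi g] :
    Epi ((coextendFG f).map g) := by
  refine fg_epi_of_surjective _ fun h => ?_
  have := R.projective_regular
  obtain ⟨l, hl⟩ := Module.projective_lifting_property g.hom.hom
    (ModuleCat.CoextendScalars.equiv f.toRingHom Y.obj h) (fg_surjective_of_epi g)
  exact ⟨(ModuleCat.CoextendScalars.equiv f.toRingHom X.obj).symm l, hl⟩

theorem coextendFG_exact : exactFunctor _ _ (coextendFG f) := by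
  have := (restrictCoextendFGAdj f).rightAdjoint_preservesLimits
  exact exactFunctor_of_preservesFiniteLimits _ fun g _ => R.epi_coextendFG_map g

theorem restrictFG_preservesProjectiveObjects : (restrictFG f).PreservesProjectiveObjects :=
  -- A left adjoint preserves projectives when its right adjoint preserves epimorphisms.
  have : (coextendFG f).PreservesEpimorphisms := ⟨fun g _ => R.epi_coextendFG_map g⟩
  Functor.preservesProjectiveObjects_of_adjunction_of_preservesEpimorphisms
    (restrictCoextendFGAdj f)

omit R in
/-- Inflation along `g` followed by restriction along `f` is the identity. -/
noncomputable def restrictFGIso : restrictFG R.g ⋙ restrictFG f ≅ 𝟭 (FGModuleCat.{x} A) :=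
  have h (X : FGModuleCat.{x} A) (a : A) (m : X) : R.g (f a) • m = a • m := by rw [R.g_f]
  NatIso.ofComponents
    (fun X =>
      { hom := ObjectProperty.homMk (ModuleCat.ofHom
          (X := ((restrictFG R.g ⋙ restrictFG f).obj X).obj)
          { toFun := fun m : X => m
            map_add' := fun _ _ => rfl
            map_smul' := h X })
        inv := ObjectProperty.homMk (ModuleCat.ofHom
          (Y := ((restrictFG R.g ⋙ restrictFG f).obj X).obj)
          { toFun := fun m : X => m
            map_add' := fun _ _ => rfl
            map_smul' := fun a m => (h X a m).symm })
        hom_inv_id := rfl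
        inv_hom_id := rfl })
    fun g => rfl

omit R in
/-- The cleft extension that comes from a split extension of algebras. -/
noncomputable def cleftExtension : CleftExtension (restrictFG f) (extendFG f) (restrictFG R.g) where
  faithful := inferInstance
  exact := restrictFG_exact f
  adj := extendRestrictFGAdj f
  iso := R.restrictFGIso

section

omit R

variable {i : FGModuleCat.{x} A ⥤ FGModuleCat.{x} B}
  (C : CleftExtension (restrictFG f) (extendFG f) i)

/-- A `B`-module, considered as an `A`-module via `f` and as a `B`-module. -/
abbrev restrict (X : FGModuleCat.{x} B) : Type x := (ModuleCat.restrictScalars f.toRingHom).obj X.obj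

instance finite_ker_counit (X : FGModuleCat.{x} B) : Module.Finite B
    (LinearMap.ker (counit (f := f) (M := restrict (f := f) X) fun _ _ => rfl)) :=
  inferInstanceAs
    (Module.Finite B (LinearMap.ker ((extendRestrictFGAdj f).counit.app X).hom.hom))

/-- For any choice of the adjunction, the functor `G` of a cleft extension is the kernel of the
multiplication map. -/
noncomputable def cleftGIso (X : FGModuleCat.{x} B) : C.G.obj X ≅
    FGModuleCat.of B (LinearMap.ker (counit (f := f) (M := restrict (f := f) X) fun _ _ => rfl)) :=
  kernel.mapIso (C.adj.counit.app X) ((extendRestrictFGAdj f).counit.app X)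
    (((C.adj.leftAdjointUniq (extendRestrictFGAdj f))).app _) (Iso.refl _)
    ((Category.comp_id _).trans (C.adj.leftAdjointUniq_hom_app_counit _ _).symm) ≪≫
  fgKernelIso ((extendRestrictFGAdj f).counit.app X)

end

omit [Module.Finite k A] in
theorem projective_G {i : FGModuleCat.{x} A ⥤ FGModuleCat.{x} B}
    (C : CleftExtension (restrictFG f) (extendFG f) i) (X : FGModuleCat.{x} B) :
    Projective (C.G.obj X) := by
  let M := restrict (f := f) X
  let _ : Module k M := Module.compHom X.obj (algebraMap k B)
  have : IsScalarTower k B M := ⟨fun c b m => by rw [Algebra.smul_def, mul_smul]; rfl⟩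
  have : IsScalarTower k A M := ⟨fun c a m => by
    change f (c • a) • (show X.obj from m) = algebraMap k B c • f a • (show X.obj from m)
    rw [map_smul, Algebra.smul_def, mul_smul]⟩
  have := R.projective_ker_counit (M := M) fun _ _ => rfl
  exact Projective.of_iso (cleftGIso C X).symm (fg_projective _)

omit [Module.Finite k A] in
theorem essImage_G_le {i : FGModuleCat.{x} A ⥤ FGModuleCat.{x} B}
    (C : CleftExtension (restrictFG f) (extendFG f) i) :
    C.G.essImage ≤ isProjective (FGModuleCat.{x} B) := by
  rintro Y ⟨X, ⟨e⟩⟩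
  exact Projective.of_iso e (R.projective_G C X)

theorem essImage_F_le {i : FGModuleCat.{x} A ⥤ FGModuleCat.{x} B}
    (C : CleftExtension (restrictFG f) (extendFG f) i) :
    C.F.essImage ≤ isProjective (FGModuleCat.{x} A) := by
  rintro Y ⟨X, ⟨e⟩⟩
  exact Projective.of_iso e
    (R.restrictFG_preservesProjectiveObjects.projective_obj (R.projective_G C _))

omit [Module.Finite k A] in
theorem ε_smul_G {i : FGModuleCat.{x} A ⥤ FGModuleCat.{x} B}
    (C : CleftExtension (restrictFG f) (extendFG f) i) (X : FGModuleCat.{x} B) (α : E)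
    (z : C.G.obj X) : f (R.ε α) • z = 0 := by
  let M := restrict (f := f) X
  let _ : Module k M := Module.compHom X.obj (algebraMap k B)
  have : IsScalarTower k B M := ⟨fun c b m => by rw [Algebra.smul_def, mul_smul]; rfl⟩
  have : IsScalarTower k A M := ⟨fun c a m => by
    change f (c • a) • (show X.obj from m) = algebraMap k B c • f a • (show X.obj from m)
    rw [map_smul, Algebra.smul_def, mul_smul]⟩
  let e := FGModuleCat.isoToLinearEquiv (cleftGIso C X)
  apply e.injective
  rw [map_smul, map_zero]
  exact Subtype.ext (R.ε_smul_eq_zero (M := M) (fun _ _ => rfl) α (LinearMap.mem_ker.1 (e z).2))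

omit [Module.Finite k A] in
theorem G_eq_zero {i : FGModuleCat.{x} A ⥤ FGModuleCat.{x} B}
    (C : CleftExtension (restrictFG f) (extendFG f) i) (X : FGModuleCat.{x} B)
    (hX : ∀ (α : E) (m : X), f (R.ε α) • m = 0) (z : C.G.obj X) : z = 0 := by
  let M := restrict (f := f) X
  let _ : Module k M := Module.compHom X.obj (algebraMap k B)
  have : IsScalarTower k B M := ⟨fun c b m => by rw [Algebra.smul_def, mul_smul]; rfl⟩
  have : IsScalarTower k A M := ⟨fun c a m => by
    change f (c • a) • (show X.obj from m) = algebraMap k B c • f a • (show X.obj from m)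
    rw [map_smul, Algebra.smul_def, mul_smul]⟩
  let e := FGModuleCat.isoToLinearEquiv (cleftGIso C X)
  apply e.injective
  rw [map_zero]
  exact Subtype.ext (R.eq_zero_of_counit_eq_zero (M := M) (fun _ _ => rfl) hX
    (LinearMap.mem_ker.1 (e z).2))

theorem isZero_F_comp_F (C : CleftExtension (restrictFG f) (extendFG f) (restrictFG R.g)) :
    IsZero (C.F ⋙ C.F) := by
  rw [Functor.isZero_iff]
  intro X
  refine fg_isZero _ fun z => R.G_eq_zero C ((restrictFG R.g).obj (C.F.obj X)) (fun α m => ?_) z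
  have h := R.ε_smul_G C ((restrictFG R.g).obj X) α m
  -- On the inflated module `f ε` acts through `g`, hence as `ε`, and restriction along `f` turns
  -- this into the action of `f ε` on a value of `G`.
  change R.g (f (R.ε α)) • (show C.F.obj X from m) = 0
  rw [R.g_f]
  exact h

end RemovalData

open MulOpposite

/-! ### Multiplying paths by trivial paths and arrows. -/

section Paths

variable {k : Type w} [Field k] {V : Type u} [Quiver.{v} V]

/-- The element of the path algebra given by an arrow. -/
noncomputable abbrev ofArrow (k : Type w) [Field k] (α : Quiver.Total V) : PathAlgebra k V :=
  ofPath k ⟨α.left, α.right, α.hom.toPath⟩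

theorem idem_mul_ofPath {x y : V} (p : Quiver.Path x y) :
    idem k x * ofPath k ⟨x, y, p⟩ = ofPath k ⟨x, y, p⟩ := by
  rw [idem, ofPath_mul_comp, Quiver.Path.nil_comp]

theorem ofPath_mul_idem {x y : V} (p : Quiver.Path x y) :
    ofPath k ⟨x, y, p⟩ * idem k y = ofPath k ⟨x, y, p⟩ := by
  rw [idem, ofPath_mul_comp, Quiver.Path.comp_nil]

theorem ofPath_cons {x y z : V} (p : Quiver.Path x y) (b : y ⟶ z) :
    ofPath k ⟨x, z, p.cons b⟩ = ofPath k ⟨x, y, p⟩ * ofArrow k ⟨y, z, b⟩ :=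
  (ofPath_mul_comp p b.toPath).symm

end Paths

/-! ### The noncommutative derivative of the path algebra at an arrow. -/

section Derivation

variable {k : Type w} [Field k] {V : Type u} [Quiver.{v} V] [Fintype V] {G : Type x} [Ring G]
  [Algebra k G] (χ : PathAlgebra k V →ₐ[k] G) (α : Quiver.Total V)

open Classical in
/-- The sum of the tensors `q ⊗ p` over all factorizations `p α q` of a path. -/
noncomputable def derivPath {x : V} :
    {y : V} → Quiver.Path x y → Gᵐᵒᵖ ⊗[k] Gᵐᵒᵖ
  | _, .nil => 0
  | _, .cons p b =>
    (op (χ (ofArrow k ⟨_, _, b⟩)) ⊗ₜ 1) * derivPath p +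
      if ⟨_, _, b⟩ = α then
        op (χ (idem k α.right)) ⊗ₜ op (χ (ofPath k ⟨_, _, p⟩))
      else 0

theorem idem_mul_derivPath {x : V} : ∀ {y : V} (p : Quiver.Path x y),
    (op (χ (idem k y)) ⊗ₜ 1) * derivPath χ α p = derivPath χ α p
  | _, .nil => mul_zero _
  | _, .cons p b => by
    rw [derivPath, mul_add, ← mul_assoc, Algebra.TensorProduct.tmul_mul_tmul, ← op_mul, ← map_mul,
      ofPath_mul_idem, one_mul]
    congr 1
    split_ifs with h
    · subst h
      rw [Algebra.TensorProduct.tmul_mul_tmul, ← op_mul, ← map_mul, idem, ofPath_mul_comp, one_mul]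
      rfl
    · rw [mul_zero]

theorem derivPath_mul_idem {x : V} : ∀ {y : V} (p : Quiver.Path x y),
    derivPath χ α p * (1 ⊗ₜ op (χ (idem k x))) = derivPath χ α p
  | _, .nil => zero_mul _
  | _, .cons p b => by
    rw [derivPath, add_mul, mul_assoc, derivPath_mul_idem p]
    congr 1
    split_ifs with h
    · rw [Algebra.TensorProduct.tmul_mul_tmul, ← op_mul, ← map_mul, idem_mul_ofPath, mul_one]
    · rw [zero_mul]

theorem derivPath_mul_right {x : V} : ∀ {y : V} (p : Quiver.Path x y),
    derivPath χ α p * (op (χ (idem k α.right)) ⊗ₜ 1) = derivPath χ α p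
  | _, .nil => zero_mul _
  | _, .cons p b => by
    rw [derivPath, add_mul, mul_assoc, derivPath_mul_right p]
    congr 1
    split_ifs with h
    · rw [Algebra.TensorProduct.tmul_mul_tmul, ← op_mul, ← map_mul, idem, ofPath_mul_comp, mul_one]
      rfl
    · rw [zero_mul]

theorem left_mul_derivPath {x : V} : ∀ {y : V} (p : Quiver.Path x y),
    (1 ⊗ₜ op (χ (idem k α.left))) * derivPath χ α p = derivPath χ α p
  | _, .nil => mul_zero _
  | _, .cons p b => by
    rw [derivPath, mul_add, ← mul_assoc, Algebra.TensorProduct.tmul_mul_tmul, one_mul, mul_one]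
    congr 1
    · conv_rhs => rw [← left_mul_derivPath p]
      rw [← mul_assoc, Algebra.TensorProduct.tmul_mul_tmul, one_mul, mul_one]
    · split_ifs with h
      · subst h
        rw [Algebra.TensorProduct.tmul_mul_tmul, ← op_mul, ← map_mul, ofPath_mul_idem, one_mul]
      · rw [mul_zero]

theorem derivPath_eq_zero {x : V} : ∀ {y : V} (p : Quiver.Path x y), α ∉ arrows p →
    derivPath χ α p = 0
  | _, .nil, _ => rfl
  | _, .cons p b, h => by
    rw [arrows, List.mem_append, List.mem_singleton, not_or] at h
    rw [derivPath, derivPath_eq_zero p h.1, mul_zero, if_neg (Ne.symm h.2), add_zero]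

/-- Leibniz rule: an occurrence of `α` in a concatenation lies either in `p` or in `q`. The factors
appear swapped because values are taken in the opposite algebra. -/
theorem derivPath_comp {x y : V} (p : Quiver.Path x y) : ∀ {z : V} (q : Quiver.Path y z),
    derivPath χ α (p.comp q) =
      (op (χ (ofPath k ⟨y, z, q⟩)) ⊗ₜ 1) * derivPath χ α p +
        derivPath χ α q * (1 ⊗ₜ op (χ (ofPath k ⟨x, y, p⟩)))
  | _, .nil => by
    rw [Quiver.Path.comp_nil, derivPath.eq_1, zero_mul, add_zero]
    exact (idem_mul_derivPath χ α p).symm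
  | _, .cons q b => by
    rw [Quiver.Path.comp_cons, derivPath, derivPath_comp p q, derivPath, mul_add, add_mul,
      ← mul_assoc, Algebra.TensorProduct.tmul_mul_tmul, ← op_mul, ← map_mul, ← ofPath_cons, one_mul,
      ← mul_assoc, add_assoc]
    congr 2
    split_ifs with h
    · rw [Algebra.TensorProduct.tmul_mul_tmul, ← op_mul, ← map_mul, ofPath_mul_comp, mul_one]
    · rw [zero_mul]

/-- The derivation of the path algebra that sends the arrow `α` to `1 ⊗ 1` (up to idempotents) and
the other arrows to `0`. -/
noncomputable def deriv : PathAlgebra k V →ₗ[k] Gᵐᵒᵖ ⊗[k] Gᵐᵒᵖ :=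
  liftLin fun p => derivPath χ α p.2.2

theorem deriv_ofPath (p : QPath V) : deriv χ α (ofPath k p) = derivPath χ α p.2.2 :=
  liftLin_ofPath _ p

theorem deriv_mul (x y : PathAlgebra k V) : deriv χ α (x * y) =
    (op (χ y) ⊗ₜ 1) * deriv χ α x + deriv χ α y * (1 ⊗ₜ op (χ x)) := by
  induction x using path_induction with
  | path p =>
    induction y using path_induction with
    | path q =>
      obtain ⟨x, y, p⟩ := p
      obtain ⟨y', z, q⟩ := q
      by_cases h : y' = y
      · subst h
        rw [ofPath_mul_comp, deriv_ofPath, deriv_ofPath, deriv_ofPath, derivPath_comp]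
      -- For non-composable paths both Leibniz terms must vanish: the derivatives absorb the trivial
      -- paths at `y` and `y'`, which then meet the other path at a wrong vertex.
      · have hp : ofPath k ⟨x, y, p⟩ * idem k y' = 0 := ofPath_mul_ne h
        have hq : idem k y * ofPath k ⟨y', z, q⟩ = 0 := ofPath_mul_ne h
        rw [ofPath_mul_ne h, map_zero, deriv_ofPath, deriv_ofPath, ← idem_mul_derivPath,
          ← derivPath_mul_idem χ α q, ← mul_assoc, mul_assoc (derivPath χ α q),
          Algebra.TensorProduct.tmul_mul_tmul, Algebra.TensorProduct.tmul_mul_tmul, ← op_mul,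
          ← op_mul, ← map_mul, ← map_mul, hp, hq]
        simp
    | zero => simp
    | add y z hy hz =>
      simp only [mul_add, map_add, MulOpposite.op_add, TensorProduct.add_tmul, add_mul, hy, hz]
      abel
    | smul c y hy =>
      simp only [mul_smul_comm, map_smul, op_smul, ← TensorProduct.smul_tmul', smul_mul_assoc,
        hy, smul_add]
  | zero => simp
  | add x y hx hy =>
    simp only [mul_add, map_add, MulOpposite.op_add, TensorProduct.tmul_add, add_mul, hx, hy]
    abel
  | smul c x hx =>
    simp only [mul_smul_comm, map_smul, op_smul, TensorProduct.tmul_smul, smul_mul_assoc,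
      hx, smul_add]

theorem deriv_mul_right (x : PathAlgebra k V) :
    deriv χ α x * (op (χ (idem k α.right)) ⊗ₜ 1) = deriv χ α x := by
  induction x using path_induction with
  | path p => rw [deriv_ofPath, derivPath_mul_right]
  | zero => simp
  | add x y hx hy => rw [map_add, add_mul, hx, hy]
  | smul c x hx => rw [map_smul, smul_mul_assoc, hx]

theorem left_mul_deriv (x : PathAlgebra k V) :
    (1 ⊗ₜ op (χ (idem k α.left))) * deriv χ α x = deriv χ α x := by
  induction x using path_induction with
  | path p => rw [deriv_ofPath, left_mul_derivPath]
  | zero => simp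
  | add x y hx hy => rw [map_add, mul_add, hx, hy]
  | smul c x hx => rw [map_smul, mul_smul_comm, hx]

variable {α} in
theorem deriv_kill {t : ℕ} {a : Fin t → Quiver.Total V} (hα : α ∈ Set.range a) (x : PathAlgebra k V) :
    deriv χ α (kill a x) = 0 := by
  obtain ⟨j, rfl⟩ := hα
  induction x using path_induction with
  | path p =>
    by_cases hp : ∀ i, a i ∉ arrows p.2.2
    · rw [kill_ofPath_of_avoids a hp, deriv_ofPath, derivPath_eq_zero χ _ _ (hp j)]
    · push Not at hp
      obtain ⟨i, hi⟩ := hp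
      rw [kill_ofPath_of_mem a i hi, map_zero]
  | zero => simp
  | add x y hx hy => simp only [map_add, hx, hy, add_zero]
  | smul c x hx => simp only [map_smul, hx, smul_zero]

variable {α} in
-- Generators avoiding the removed arrows have derivative zero, and the Leibniz rule spreads this to
-- the ideal they generate.
theorem deriv_eq_zero {t : ℕ} {a : Fin t → Quiver.Total V} {I : TwoSidedIdeal (PathAlgebra k V)}
    (ha : AvoidsMinimalGenerators I a) (hα : α ∈ Set.range a)
    (hχ : ∀ x, χ (kill a x) = χ x) (hI : ∀ x ∈ I, χ x = 0)
    {x : PathAlgebra k V} (hx : x ∈ I) : deriv χ α x = 0 := by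
  obtain ⟨S, ⟨hS, -⟩, hSa⟩ := ha
  -- The kernel of a derivation need not be an ideal; its intersection with the kernel of `χ` is.
  let K : TwoSidedIdeal (PathAlgebra k V) := TwoSidedIdeal.mk'
    {y | χ y = 0 ∧ deriv χ α y = 0}
    ⟨map_zero _, map_zero _⟩
    (fun h h' => ⟨by rw [map_add, h.1, h'.1, add_zero], by rw [map_add, h.2, h'.2, add_zero]⟩)
    (fun h => ⟨by rw [map_neg, h.1, neg_zero], by rw [map_neg, h.2, neg_zero]⟩)
    (fun h => ⟨by rw [map_mul, h.1, mul_zero], by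
      rw [deriv_mul, h.1, h.2, MulOpposite.op_zero, TensorProduct.zero_tmul, zero_mul, zero_mul, add_zero]⟩)
    (fun h => ⟨by rw [map_mul, h.1, zero_mul], by
      rw [deriv_mul, h.1, h.2, MulOpposite.op_zero, TensorProduct.tmul_zero, mul_zero, mul_zero, add_zero]⟩)
  have hK (y) : y ∈ K ↔ χ y = 0 ∧ deriv χ α y = 0 := TwoSidedIdeal.mem_mk' _ _ _ _ _ _ _
  have h : TwoSidedIdeal.span S ≤ K := by
    rw [TwoSidedIdeal.span_le]
    intro s hs
    rw [SetLike.mem_coe, hK, ← kill_of_avoids a (hSa s hs)]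
    refine ⟨?_, deriv_kill χ hα s⟩
    rw [hχ]
    exact hI s (hS ▸ TwoSidedIdeal.subset_span hs)
  exact ((hK x).1 (h (hS ▸ hx))).2

/-! ### Every element is recovered from its class in `Γ` and its derivatives. -/

section Decomposition

variable {L : Type x} [Ring L] [Algebra k L] (ψ : PathAlgebra k V →ₐ[k] L) {χ}
  {f : Gᵐᵒᵖ →ₐ[k] Lᵐᵒᵖ} {t : ℕ} {a : Fin t → Quiver.Total V}
  (hf : ∀ x, f (op (χ x)) = op (ψ (kill a x)))
  (hv : ∀ (α β : Set.range a) (x : Lᵐᵒᵖ),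
    f (op (χ (idem k α.1.left))) * x * f (op (χ (idem k β.1.right))) = 0)

theorem kill_idem {t : ℕ} (a : Fin t → Quiver.Total V) (x : V) : kill a (idem k x) = idem k x :=
  kill_ofPath_of_avoids a fun i => by simp [arrows]

theorem kill_ofArrow_of_notMem {α : Quiver.Total V} (hα : α ∉ Set.range a) :
    kill a (ofArrow k α) = ofArrow k α := by
  refine kill_ofPath_of_avoids a fun i hi => hα ⟨i, ?_⟩
  simpa [Quiver.Hom.toPath, arrows] using hi

include hf in
theorem arrow_mul_idem (α : Quiver.Total V) :
    op (ψ (ofArrow k α)) * f (op (χ (idem k α.left))) = op (ψ (ofArrow k α)) := by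
  rw [hf, kill_idem, ← op_mul, ← map_mul, idem_mul_ofPath]

include hf in
theorem idem_mul_arrow (α : Quiver.Total V) :
    f (op (χ (idem k α.right))) * op (ψ (ofArrow k α)) = op (ψ (ofArrow k α)) := by
  rw [hf, kill_idem, ← op_mul, ← map_mul, ofPath_mul_idem]

include hf hv in
-- The product runs through two removed arrows, so it contains a factor `ε v φ`, zero by `hv`.
theorem arrow_mul_sandwich (α β : Set.range a) (w : Gᵐᵒᵖ ⊗[k] Gᵐᵒᵖ) :
    op (ψ (ofArrow k α.1)) * sandwich f (op (ψ (ofArrow k β.1))) w = 0 := by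
  induction w with
  | zero => rw [map_zero, mul_zero]
  | tmul v u =>
    rw [sandwich_tmul, ← arrow_mul_idem ψ hf, ← idem_mul_arrow ψ hf β.1, ← mul_assoc (f v),
      ← mul_assoc, ← mul_assoc, mul_assoc (op _), mul_assoc (op _), ← mul_assoc (f _) (f v), hv,
      zero_mul, mul_zero, zero_mul]
  | add y z hy hz => rw [map_add, mul_add, hy, hz, add_zero]

include hf hv in
-- Induction on the path, by its last arrow. A removed last arrow kills every earlier removed arrow
-- and leaves one new sandwich term; any other arrow just multiplies the formula.
theorem op_eq_add_sum_sandwich [Fintype (Set.range a)] (hχ : ∀ α ∈ Set.range a, χ (ofArrow k α) = 0)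
    (x : PathAlgebra k V) : op (ψ x) =
      f (op (χ x)) + ∑ α : Set.range a, sandwich f (op (ψ (ofArrow k α.1))) (deriv χ α.1 x) := by
  induction x using path_induction with
  | path p =>
    obtain ⟨x, y, p⟩ := p
    simp only [deriv_ofPath]
    induction p with
    | nil =>
      simp only [derivPath.eq_1, map_zero, Finset.sum_const_zero, add_zero, hf]
      exact congrArg (fun y => op (ψ y)) (kill_idem a x).symm
    | @cons y z p b ih =>
      rw [ofPath_cons, map_mul, map_mul, op_mul, op_mul, map_mul]
      simp only [derivPath, map_add, sandwich_mul]
      by_cases hb : (⟨y, z, b⟩ : Quiver.Total V) ∈ Set.range a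
      · rw [hχ _ hb, MulOpposite.op_zero, map_zero, zero_mul, zero_add]
        simp only [zero_mul, zero_add]
        rw [Finset.sum_eq_single_of_mem ⟨_, hb⟩ (Finset.mem_univ _), if_pos rfl, sandwich_tmul,
          idem_mul_arrow ψ hf]
        · conv_lhs => rw [ih]
          rw [mul_add, Finset.mul_sum, Finset.sum_eq_zero, add_zero]
          exact fun β _ => arrow_mul_sandwich ψ hf hv ⟨_, hb⟩ β _
        · intro β _ hβ
          rw [if_neg fun h => hβ (Subtype.ext h.symm), map_zero]
      · have h (β : Set.range a) : (⟨y, z, b⟩ : Quiver.Total V) ≠ β.1 := fun h => hb (h ▸ β.2)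
        simp only [if_neg (h _), map_zero, add_zero]
        rw [hf (ofArrow k _), kill_ofArrow_of_notMem hb, ← Finset.mul_sum, ← mul_add, ← ih]
  | zero => simp
  | add x y hx hy =>
    simp only [map_add, MulOpposite.op_add, Finset.sum_add_distrib]
    rw [hx, hy]
    abel
  | smul c x hx =>
    simp only [map_smul, op_smul, ← Finset.smul_sum, ← smul_add]
    rw [hx]

end Decomposition

end Derivation

/-! ### The removal data of `Λ` and `Γ`. -/

section Quiver

variable {k : Type w} [Field k] {V : Type u} [Quiver.{v} V] [Fintype V]
  (I : TwoSidedIdeal (PathAlgebra k V)) {t : ℕ} (a : Fin t → Quiver.Total V)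

/-- The projection `kQ → Λ`. -/
noncomputable def toLam : PathAlgebra k V →ₐ[k] Lam I := Ideal.Quotient.mkₐ k I.asIdeal

/-- The projection `kQ → Γ`. -/
noncomputable def toGam : PathAlgebra k V →ₐ[k] Gam I a := (proj I a).comp (toLam I)

variable {a}

theorem toGam_ofArrow {α : Quiver.Total V} (hα : α ∈ Set.range a) :
    toGam I a (ofArrow k α) = 0 := by
  obtain ⟨i, rfl⟩ := hα
  exact Ideal.Quotient.eq_zero_iff_mem.2 (TwoSidedIdeal.mem_asIdeal.2
    (TwoSidedIdeal.subset_span ⟨i, rfl⟩))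

theorem toGam_ofPath_of_mem (i : Fin t) {x : V} : ∀ {y : V} (p : Quiver.Path x y),
    a i ∈ arrows p → toGam I a (ofPath k ⟨x, y, p⟩) = 0
  | _, .nil, h => by simp [arrows] at h
  | _, .cons p b, h => by
    rw [ofPath_cons, map_mul]
    rw [arrows, List.mem_append, List.mem_singleton] at h
    rcases h with h | h
    · rw [toGam_ofPath_of_mem i p h, zero_mul]
    · rw [toGam_ofArrow I ⟨i, h⟩, mul_zero]

theorem toGam_kill (x : PathAlgebra k V) : toGam I a (kill a x) = toGam I a x := by
  induction x using path_induction with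
  | path p =>
    by_cases hp : ∀ i, a i ∉ arrows p.2.2
    · rw [kill_ofPath_of_avoids a hp]
    · push Not at hp
      obtain ⟨i, hi⟩ := hp
      rw [kill_ofPath_of_mem a i hi, map_zero, toGam_ofPath_of_mem I i _ hi]
  | zero => simp
  | add x y hx hy => simp only [map_add, hx, hy]
  | smul c x hx => simp only [map_smul, hx]

variable {I} in
theorem incl_toGam (ha : AvoidsMinimalGenerators I a) (x : PathAlgebra k V) :
    incl ha (toGam I a x) = toLam I (kill a x) := rfl

theorem toLam_surjective : Function.Surjective (toLam I) := Ideal.Quotient.mk_surjective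

variable (a) in
theorem toGam_surjective : Function.Surjective (toGam I a) :=
  Ideal.Quotient.mk_surjective.comp Ideal.Quotient.mk_surjective

variable {I} in
theorem proj_incl (ha : AvoidsMinimalGenerators I a) (y : Gam I a) :
    proj I a (incl ha y) = y := by
  obtain ⟨x, rfl⟩ := toGam_surjective I a y
  exact toGam_kill I x

variable (a) (α : Quiver.Total V)

theorem toGam_eq_zero {x : PathAlgebra k V} (hx : x ∈ I) : toGam I a x = 0 := by
  have h : toLam I x = 0 := Ideal.Quotient.eq_zero_iff_mem.2 (TwoSidedIdeal.mem_asIdeal.2 hx)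
  rw [toGam, AlgHom.comp_apply, h, map_zero]

variable {α a I}

/-- The derivation of `Λ` induced by `deriv`. -/
noncomputable def derivLam (ha : AvoidsMinimalGenerators I a) (hα : α ∈ Set.range a) :
    (Lam I)ᵐᵒᵖ →ₗ[k] (Gam I a)ᵐᵒᵖ ⊗[k] (Gam I a)ᵐᵒᵖ :=
  ((I.asIdeal.restrictScalars k).liftQ (deriv (toGam I a) α) fun _ hx =>
    deriv_eq_zero (toGam I a) ha hα (toGam_kill I) (fun _ => toGam_eq_zero I a)
      (TwoSidedIdeal.mem_asIdeal.1 hx)) ∘ₗ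
  (Submodule.Quotient.restrictScalarsEquiv k I.asIdeal).symm.toLinearMap ∘ₗ
  (opLinearEquiv k).symm.toLinearMap

/-- Left multiplication by `f_j x` is a homomorphism `e_i Λ → f_j Λ`; it is zero by hypothesis and
is evaluated at `e_i`. -/
theorem idem_mul_mul_idem {i j : Fin t}
    (h : ∀ φ : rightIdeal I (a i).left →ₗ[(Lam I)ᵐᵒᵖ] rightIdeal I (a j).right, φ = 0) (x : Lam I) :
    toLam I (idem k (a j).right) * x * toLam I (idem k (a i).left) = 0 := by
  have he : toLam I (idem k (a i).left) * toLam I (idem k (a i).left) =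
      toLam I (idem k (a i).left) := by
    rw [← map_mul, idem, ofPath_mul_comp, Quiver.Path.comp_nil]
  let c : Lam I := toLam I (idem k (a j).right) * x
  let m : Lam I →ₗ[(Lam I)ᵐᵒᵖ] Lam I :=
    { toFun := fun y => c * y
      map_add' := mul_add c
      map_smul' := fun r y => (mul_assoc c y r.unop).symm }
  have hm (y) : m y ∈ rightIdeal I (a j).right := by
    have : m y = op (x * y) • toLam I (idem k (a j).right) := mul_assoc _ x y
    rw [this]
    exact Submodule.smul_mem _ _ (Submodule.subset_span rfl)
  have h0 := h ((m.domRestrict _).codRestrict _ fun y => hm y.1)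
  exact congrArg Subtype.val (LinearMap.congr_fun h0
    ⟨toLam I (idem k (a i).left), Submodule.subset_span rfl⟩)

variable (ha : AvoidsMinimalGenerators I a)
    (hHom : ∀ (i j : Fin t) (φ : rightIdeal I (a i).left →ₗ[(Lam I)ᵐᵒᵖ] rightIdeal I (a j).right),
      φ = 0)

/-- The index set is the range of `a`, so that an arrow listed twice contributes only once to the
decomposition. -/
noncomputable instance : Fintype (Set.range a) := Fintype.ofFinite _

include hHom in
theorem vanish_aux (α β : Set.range a) (x : (Lam I)ᵐᵒᵖ) :
    (incl ha).op (op (toGam I a (idem k α.1.left))) * x *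
      (incl ha).op (op (toGam I a (idem k β.1.right))) = 0 := by
  obtain ⟨_, i, rfl⟩ := α
  obtain ⟨_, j, rfl⟩ := β
  apply unop_injective
  change incl ha (toGam I a _) * (x.unop * incl ha (toGam I a _)) = 0
  rw [incl_toGam, incl_toGam, kill_idem, kill_idem, ← mul_assoc]
  exact idem_mul_mul_idem (hHom i j) x.unop

/-- The arrow removal as an instance of `RemovalData`. -/
noncomputable def removalData :
    RemovalData k (Gam I a)ᵐᵒᵖ (Lam I)ᵐᵒᵖ (incl ha).op (Set.range a) where
  g := (proj I a).op
  g_f y := unop_injective (proj_incl ha y.unop)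
  r α := op (toLam I (ofArrow k α.1))
  ε α := op (toGam I a (idem k α.1.left))
  φ α := op (toGam I a (idem k α.1.right))
  D α := derivLam ha α.2
  D_mul α x y := by
    obtain ⟨x⟩ := x
    obtain ⟨y⟩ := y
    obtain ⟨x, rfl⟩ := toLam_surjective I x
    obtain ⟨y, rfl⟩ := toLam_surjective I y
    -- The arguments are swapped because the product is taken in the opposite algebra.
    exact deriv_mul (toGam I a) α.1 y x
  D_f α y := by
    obtain ⟨y⟩ := y
    obtain ⟨y, rfl⟩ := toGam_surjective I a y
    exact deriv_kill (toGam I a) α.2 y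
  ε_mul_D α x := by
    obtain ⟨x⟩ := x
    obtain ⟨x, rfl⟩ := toLam_surjective I x
    exact left_mul_deriv (toGam I a) α.1 x
  D_mul_φ α x := by
    obtain ⟨x⟩ := x
    obtain ⟨x, rfl⟩ := toLam_surjective I x
    exact deriv_mul_right (toGam I a) α.1 x
  decomp x := by
    obtain ⟨x⟩ := x
    obtain ⟨x, rfl⟩ := toLam_surjective I x
    exact op_eq_add_sum_sandwich (toLam I) (fun _ => rfl) (vanish_aux ha hHom)
      (fun _ => toGam_ofArrow I) x
  φ_mul_r α := idem_mul_arrow (a := a) (toLam I) (fun _ => rfl) α.1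
  r_mul_ε α := arrow_mul_idem (a := a) (toLam I) (fun _ => rfl) α.1
  vanish := vanish_aux ha hHom

end Quiver

end ArrowRemoval

theorem mainTheorem9 {k : Type w} [Field k] {V : Type u} [Quiver.{v} V] [Fintype V]
    [∀ x y : V, Finite (x ⟶ y)] (I : TwoSidedIdeal (PathAlgebra k V)) [IsAdmissible I]
    {t : ℕ} (a : Fin t → Quiver.Total V) (ha : AvoidsMinimalGenerators I a)
    (hHom : ∀ (i j : Fin t) (φ : rightIdeal I (a i).left →ₗ[(Lam I)ᵐᵒᵖ] rightIdeal I (a j).right),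
      φ = 0) :
    Nonempty (CleftExtension (functorE ha) (functorL ha) (functorI I a)) ∧
    exactFunctor _ _ (functorL ha) ∧
    exactFunctor _ _ (functorR ha) ∧
    (functorE ha).PreservesProjectiveObjects ∧
    ∀ C : CleftExtension (functorE ha) (functorL ha) (functorI I a),
      C.F.essImage ≤ isProjective (ModR (Gam I a)) ∧
      IsZero (C.F ⋙ C.F) ∧
      C.G.essImage ≤ isProjective (ModR (Lam I)) := by
  let R := removalData ha hHom
  exact ⟨⟨R.cleftExtension⟩, R.extendFG_exact, R.coextendFG_exact,
    R.restrictFG_preservesProjectiveObjects, fun C =>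
      ⟨R.essImage_F_le C, R.isZero_F_comp_F C, R.essImage_G_le C⟩⟩
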